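/- Let $g\ge 2$. Set $\theta=\frac{(2g-1)\pi}{4g}$, $a=\frac{\cos\frac{\pi}{4g}+\sqrt{\cos\frac{\pi}{2g}}}{\sin\frac{\pi}{4g}}$, $M_g=\begin{pmatrix}\cos\theta&\sin\theta\\-\sin\theta&\cos\theta\end{pmatrix}$, $Q_g=\begin{pmatrix}a&0\\0&a^{-1}\end{pmatrix}$, and for $1\le j\le 2g$ let $c_j$ be the hyperbolic translation of $\mathbb H^2$ given by the Möbius action of $M_g^{-j}Q_gM_g^{j}$. Let $\Gamma_g$ be the group generated by $c_1,\dots,c_{2g}$, let $F_g=\mathbb H^2/\Gamma_g$ (the closed oriented surface of genus $g$), let $p:\mathbb H^2\to F_g$ be the projection, and put $\tilde y_0=i$, $p_{S^1}(t)=e^{2\pi i t}$. Let $u_1\cdots u_m$ and $v_1\cdots v_n$ ($m,n\ge1$) be words in the letters $c_j^{\pm1}$ that are cyclically reduced, i.e. no two cyclically adjacent letters are inverse to each other. Subscripts of letters are read modulo $m$ and $n$, respectively. Write $u_1\cdots u_k$ also for $k\in\mathbb Z$: if $k=am+r$ with $0\le r<m$, it is $(u_1\cdots u_m)^a\,u_1\cdots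 u_r$; likewise $v_1\cdots v_l$. Let $\varphi,\psi:S^1\to F_g$ be the piecewise-geodesic loops determined by these words: for $1\le k\le m$ and $\lambda\in[0,1]$, $\varphi(e^{2\pi i(k-1+\lambda)/m})=p(\gamma_k(\lambda))$, where $\gamma_k:[0,1]\to\mathbb H^2$ is the constant-speed geodesic from $\tilde y_0$ to $u_k(\tilde y_0)$; similarly for $\psi$ with $n$ and the $v_l$. Let $\mathrm{CVP}(\varphi,\psi)=\{(x,y)\in S^1\times S^1:\varphi(x)=\psi(y)\}$, and similarly $\mathrm{CVP}(\tilde\varphi,\tilde\psi)\subset\mathbb R^2$ for liftings $\tilde\varphi,\tilde\psi:\mathbb R\to\mathbb H^2$ of $\varphi\circ p_{S^1},\psi\circ p_{S^1}$. The common value class determined by $(\tilde\varphi,\tilde\psi)$ is the set $(p_{S^1}\times p_{S^1})(\mathrm{CVP}(\tilde\varphi,\tilde\psi))$, if it is non-empty. The standard lifting is the lifting that takes $0$ to $\tilde y_0$. **(A)** Every connected component of $\mathrm{CVP}(\varphi,\psi)$ has, for some integers $k,l$, one of the forms 1. $\{(e^{2\pi i k/m},e^{2\pi i l/n})\}$;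 2. $\{(e^{2\pi i (k+\lambda)/m},e^{2\pi i (l+\lambda)/n}) : 0\le\lambda\le q\}$ for some positive integer $q$; 3. $\{(e^{2\pi i (k+\lambda)/m},e^{2\pi i (l+q-\lambda)/n}) : 0\le\lambda\le q\}$ for some positive integer $q$; 4. $\{(e^{2\pi i (k+\lambda)/m},e^{2\pi i (l+\lambda)/n}) : \lambda\in\mathbb R\}$; 5. $\{(e^{2\pi i (k+\lambda)/m},e^{2\pi i (l-\lambda)/n}) : \lambda\in\mathbb R\}$. **(B)** Let $\tilde\varphi_S,\tilde\psi_S$ be the standard liftings of $\varphi,\psi$. For all integers $k,l$, the set determined by $((u_1\cdots u_k)^{-1}\tilde\varphi_S,\,(v_1\cdots v_l)^{-1}\tilde\psi_S)$ contains $(e^{2\pi i k/m},e^{2\pi i l/n})$, and it is the one and only common value class that contains this pair. **(C)** If a component of $\mathrm{CVP}(\varphi,\psi)$ has one of the forms above with data $k,l$ (and $q$), where in forms 2 and 3 the segment is not already the whole closed curve of form 4, respectively 5, that contains it, then accordingly 1. $u_k\ne v_l$, $u_{k+1}\ne v_{l+1}$, $v_l^{-1}\ne u_{k+1}$ and $u_k\ne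 v_{l+1}^{-1}$; 2. $u_{k+r}=v_{l+r}$ for $r=1,\dots,q$, $u_k\ne v_l$ and $u_{k+q+1}\ne v_{l+q+1}$; 3. $u_{k+r}=v_{l+q-r+1}^{-1}$ for $r=1,\dots,q$, $u_k\ne v_{l+q+1}^{-1}$ and $u_{k+q+1}\ne v_l^{-1}$; 4. $u_{k+r}=v_{l+r}$ for all integers $r$; 5. $u_{k+r}=v_{l-r+1}^{-1}$ for all integers $r$. (In (C), equality of letters means equality as symbols.) -/

import Mathlib

/-! Loops on the closed hyperbolic surface of genus `g ≥ 2` and their common value pairs. -/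

noncomputable section

open UpperHalfPlane Set
open scoped MatrixGroups

namespace CommonValue

/-! ### The surface -/

/-- The matrix `M_g`. It fixes the point `i` of the upper half-plane. -/
def rotM (g : ℕ) : SL(2, ℝ) :=
  ⟨!![Real.cos ((2 * g - 1) * Real.pi / (4 * g)), Real.sin ((2 * g - 1) * Real.pi / (4 * g));
      -Real.sin ((2 * g - 1) * Real.pi / (4 * g)), Real.cos ((2 * g - 1) * Real.pi / (4 * g))], by
    rw [Matrix.det_fin_two_of]
    nlinarith [Real.sin_sq_add_cos_sq ((2 * g - 1) * Real.pi / (4 * g))]⟩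

/-- The upper left entry of `Q_g`. -/
def stretch (g : ℕ) : ℝ :=
  (Real.cos (Real.pi / (4 * g)) + √(Real.cos (Real.pi / (2 * g)))) / Real.sin (Real.pi / (4 * g))

theorem stretch_pos (g : ℕ) [Nat.AtLeastTwo g] : 0 < stretch g := by
  have hg : (2 : ℝ) ≤ g := by exact_mod_cast Nat.AtLeastTwo.prop (n := g)
  have h0 : 0 < Real.pi / (4 * g) := by positivity
  have h1 : Real.pi / (4 * g) < Real.pi / 2 := by
    apply div_lt_div_of_pos_left Real.pi_pos <;> linarith
  have hc : 0 < Real.cos (Real.pi / (4 * g)) := Real.cos_pos_of_mem_Ioo ⟨by linarith, h1⟩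
  have hs : 0 < Real.sin (Real.pi / (4 * g)) :=
    Real.sin_pos_of_pos_of_lt_pi h0 (by linarith [Real.pi_pos])
  unfold stretch
  positivity

/-- The matrix `Q_g`, a hyperbolic translation along the imaginary axis. -/
def transQ (g : ℕ) [Nat.AtLeastTwo g] : SL(2, ℝ) :=
  ⟨!![stretch g, 0; 0, (stretch g)⁻¹], by
    rw [Matrix.det_fin_two_of, mul_inv_cancel₀ (stretch_pos g).ne']; simp⟩

/-- The hyperbolic translation `δ_j`, given by `M_g ^ (-j) * Q_g * M_g ^ j`. -/
def delta (g : ℕ) [Nat.AtLeastTwo g] (j : ℕ) : SL(2, ℝ) :=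
  (rotM g ^ j)⁻¹ * transQ g * rotM g ^ j

/-- The group `Γ_g`, generated by `δ_1, …, δ_{2g}` and acting on `ℍ` by Möbius transformations. -/
def surfaceGroup (g : ℕ) [Nat.AtLeastTwo g] : Subgroup SL(2, ℝ) :=
  Subgroup.closure (delta g '' Set.Icc 1 (2 * g))

/-- The closed surface `F_g = ℍ / Γ_g`, with the quotient topology. -/
abbrev Surface (g : ℕ) [Nat.AtLeastTwo g] : Type :=
  Quotient (MulAction.orbitRel (surfaceGroup g) ℍ)

/-- The universal covering map `p : ℍ → F_g`. -/
def proj (g : ℕ) [Nat.AtLeastTwo g] (z : ℍ) : Surface g := Quotient.mk _ z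

/-! ### Letters and words -/

/-- A letter `c_j` or `c_j⁻¹` with `1 ≤ j ≤ 2g`: the pair `(j, true)` is `c_{j+1}`, the pair
`(j, false)` is its inverse (the index in `Fin (2 * g)` starts at `0`). -/
abbrev Letter (g : ℕ) : Type := Fin (2 * g) × Bool

/-- The inverse letter. -/
def Letter.inverse {g : ℕ} (a : Letter g) : Letter g := (a.1, !a.2)

/-- The covering transformation that a letter stands for. -/
def Letter.deck {g : ℕ} [Nat.AtLeastTwo g] (a : Letter g) : SL(2, ℝ) :=
  if a.2 then delta g (a.1 + 1) else (delta g (a.1 + 1))⁻¹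

/-- The letter `u_k` of the word `u_1 ⋯ u_m`, the subscript being read modulo `m`.
(`u : Fin m → Letter g` is indexed from `0`, so that `u_1 = u 0`.) -/
def letterAt {g m : ℕ} [NeZero m] (u : Fin m → Letter g) (k : ℤ) : Letter g :=
  u ⟨((k - 1) % m).toNat, by
    have hm : (0 : ℤ) < m := by exact_mod_cast NeZero.pos m
    have h1 := Int.emod_nonneg (k - 1) hm.ne'
    have h2 := Int.emod_lt_of_pos (k - 1) hm
    omega⟩

/-- No two cyclically adjacent letters of the word are inverse to each other. -/
def CyclicallyReduced {g m : ℕ} [NeZero m] (u : Fin m → Letter g) : Prop :=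
  ∀ k : ℤ, letterAt u (k + 1) ≠ (letterAt u k).inverse

/-- The covering transformation `u_1 ⋯ u_k`. For an arbitrary integer `k = a m + r` with
`0 ≤ r < m` this is `(u_1 ⋯ u_m) ^ a * (u_1 ⋯ u_r)`. -/
def prefixDeck {g m : ℕ} [Nat.AtLeastTwo g] (u : Fin m → Letter g) (k : ℤ) : SL(2, ℝ) :=
  (List.ofFn fun j => (u j).deck).prod ^ (k / m) *
    ((List.ofFn fun j => (u j).deck).take (k % m).toNat).prod

/-! ### Loops and liftings -/

/-- The universal covering `ℝ → S¹`, `t ↦ e^{2π i t}`. -/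
def circleCover (t : ℝ) : Circle := Circle.exp (2 * Real.pi * t)

/-- `γ`, restricted to `[0, 1]`, is the geodesic from `x` to `y` of constant speed. -/
def IsGeodesic (γ : ℝ → ℍ) (x y : ℍ) : Prop :=
  γ 0 = x ∧ γ 1 = y ∧
    ∀ s ∈ Icc (0 : ℝ) 1, ∀ t ∈ Icc (0 : ℝ) 1, dist (γ s) (γ t) = |s - t| * dist x y

/-- `φ` is the piecewise-geodesic loop given by the word `u_1 ⋯ u_m`: on the arc from
`e^{2π i (k-1)/m}` to `e^{2π i k/m}` it is the image in `F_g` of the geodesic of constant speed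
from `i` to `u_k i`. (In the code `k` starts at `0`.) -/
def IsPiecewiseGeodesicLoop {g m : ℕ} [Nat.AtLeastTwo g] (u : Fin m → Letter g)
    (φ : C(Circle, Surface g)) : Prop :=
  ∀ k : Fin m, ∃ γ : ℝ → ℍ, IsGeodesic γ I ((u k).deck • I) ∧
    ∀ t ∈ Icc (0 : ℝ) 1, φ (circleCover (((k : ℕ) + t) / m)) = proj g (γ t)

/-- `f : ℝ → ℍ` is a lifting of the loop `φ`. -/
def IsLifting {g : ℕ} [Nat.AtLeastTwo g] (φ : C(Circle, Surface g)) (f : ℝ → ℍ) : Prop :=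
  Continuous f ∧ ∀ t, proj g (f t) = φ (circleCover t)

/-- The standard lifting is the one that starts at `i`. -/
def IsStandardLifting {g : ℕ} [Nat.AtLeastTwo g] (φ : C(Circle, Surface g)) (f : ℝ → ℍ) : Prop :=
  IsLifting φ f ∧ f 0 = I

/-! ### Common value pairs and classes -/

/-- The set of common value pairs of two maps. -/
def cvp {X Y Z : Type*} (φ : X → Z) (ψ : Y → Z) : Set (X × Y) := {x | φ x.1 = ψ x.2}

/-- The subset of `S¹ × S¹` determined by two liftings: the image of their set of common value
pairs. -/
def classOf (f h : ℝ → ℍ) : Set (Circle × Circle) :=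
  Prod.map circleCover circleCover '' cvp f h

/-- A common value class of two loops: a non-empty set determined by a pair of liftings. -/
def IsCommonValueClass {g : ℕ} [Nat.AtLeastTwo g] (φ ψ : C(Circle, Surface g))
    (C : Set (Circle × Circle)) : Prop :=
  C.Nonempty ∧ ∃ f h : ℝ → ℍ, IsLifting φ f ∧ IsLifting ψ h ∧ C = classOf f h

/-! ### The five forms -/

/-- The point `(e^{2π i s/m}, e^{2π i t/n})`. -/
def torusPoint (m n : ℕ) (s t : ℝ) : Circle × Circle := (circleCover (s / m), circleCover (t / n))

/-- `{(e^{2π i (k+r)/m}, e^{2π i (l+r)/n}) | 0 ≤ r ≤ q}` -/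
def parallelSegment (m n : ℕ) (k l : ℤ) (q : ℕ) : Set (Circle × Circle) :=
  (fun r : ℝ => torusPoint m n (k + r) (l + r)) '' Icc (0 : ℝ) q

/-- `{(e^{2π i (k+r)/m}, e^{2π i (l+q-r)/n}) | 0 ≤ r ≤ q}` -/
def antiparallelSegment (m n : ℕ) (k l : ℤ) (q : ℕ) : Set (Circle × Circle) :=
  (fun r : ℝ => torusPoint m n (k + r) (l + q - r)) '' Icc (0 : ℝ) q

/-- `{(e^{2π i (k+r)/m}, e^{2π i (l+r)/n}) | r ∈ ℝ}` -/
def parallelLine (m n : ℕ) (k l : ℤ) : Set (Circle × Circle) :=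
  range fun r : ℝ => torusPoint m n (k + r) (l + r)

/-- `{(e^{2π i (k+r)/m}, e^{2π i (l-r)/n}) | r ∈ ℝ}` -/
def antiparallelLine (m n : ℕ) (k l : ℤ) : Set (Circle × Circle) :=
  range fun r : ℝ => torusPoint m n (k + r) (l - r)

end CommonValue

end

/-! The theorem splits into a geometric fact and a combinatorial one. Geometrically, the translates
of the edges from `i` to `c_j^{±1} i` are edges of the regular tessellation by 4g-gons, 4g at each
vertex. In `F_g` they become a wedge of 2g embedded circles: away from the vertex, two letters give
a common point only if they are equal or inverse, and then at corresponding parameters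
(`edge_eq_edge`, `proj_edge_eq_iff`). Combinatorially, the common value pairs of two closed paths in
such a wedge are the lattice points of the torus together with diagonals and antidiagonals of unit
squares, one for each pair of equal or inverse letters. In reduced words a diagonal and an
antidiagonal never meet, so a component is a lattice point or a maximal run of matching letters,
which is a segment or a closed curve.

The geometry comes from Coxeter groups rather than from a polygon theorem. Half an edge is a side of
the triangle with angles π/4g, π/2, π/4g. Its reflection group acts on real 2×2 matrices by `X ↦ -R
X R`, where the `R` are unit normals of the sides, and `ptMatrix` embeds the half-plane
equivariantly into the traceless ones. Ascents send simple roots to positive roots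
(`rep_root_nonneg`); hence the triangle meets every orbit at most once, and stabilizers are
generated by the sides through a point (`rep_eq_self_of_mem_chamber`). The group `Γ_g` acts through
the kernel of a homomorphism to the dihedral group of order 8g, `dihedralChar`, which is injective
on the rotations about `i` and about the midpoint of an edge. It therefore separates the 4g
directions at `i`, and it shows that an element of `Γ_g` fixing a point of an edge acts trivially.

For (B), this freeness and the discreteness of orbits (`exists_ball_free`) give unique lifting for
paths in the graph (`eqOn_of_proj_eq`). Two pairs of liftings that meet over the same lattice pair
then differ by a common covering transformation and integer shifts of the parameters. For (A) and
(C), the structure `IsCoincidenceSet` retains only the combinatorics;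
`IsCoincidenceSet.connectedComponentIn_diagonal` identifies the parallel components, and the
symmetry `IsCoincidenceSet.flip` turns antiparallel ones into parallel ones. -/

noncomputable section

open UpperHalfPlane Set
open scoped MatrixGroups

namespace CommonValue

set_option linter.unusedSectionVars false

/-! ### Reflection groups in an algebra -/

section Reflection

variable {A : Type*} [Ring A] [Algebra ℝ A]

/-- The linear map `x ↦ -r x r`. If `r ^ 2 = 1`, it maps `r` to `-r`. -/
def reflection (r : A) : Module.End ℝ A := -(LinearMap.mulLeftRight ℝ (r, r))

theorem reflection_apply (r x : A) : reflection r x = -(r * x * r) := by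
  simp [reflection]

/-- The relation says that `p` has eigenvalues `-e^{±iθ}`, so its powers obey the Chebyshev
recursion. The factor `sin θ` avoids division. -/
theorem mul_pow_eq_of_add_swap {p : A} {θ : ℝ} (h : p * p = -(2 * Real.cos θ) • p - 1) (n : ℕ) :
    Real.sin θ • p ^ (n + 1) =
      (-1 : ℝ) ^ n • (Real.sin ((n + 1) * θ) • p + Real.sin (n * θ) • (1 : A)) := by
  induction n with
  | zero => simp
  | succ n ih =>
    have h2 : Real.sin ((n + 1 + 1) * θ) = 2 * Real.cos θ * Real.sin ((n + 1) * θ)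
        - Real.sin (n * θ) := by
      have e1 : ((n : ℝ) + 1 + 1) * θ = (n + 1) * θ + θ := by ring
      have e2 : (n : ℝ) * θ = (n + 1) * θ - θ := by ring
      rw [e1, e2, Real.sin_add, Real.sin_sub]; ring
    rw [pow_succ, ← smul_mul_assoc, ih, smul_mul_assoc, add_mul, smul_mul_assoc, smul_mul_assoc,
      one_mul, h]
    push_cast
    rw [h2]
    module

/-- The product `r r'` satisfies the quadratic relation above with θ = π/m, where `sin (mθ) = 0` and
`sin ((m-1)θ) = sin θ`. Being scalar, the power acts trivially by conjugation, which gives the braid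
relation. -/
theorem mul_pow_eq_neg_one_pow {r r' : A} {m : ℕ} (hm : 2 ≤ m) (hr : r * r = 1)
    (hr' : r' * r' = 1)
    (h : r * r' + r' * r = (-(2 * Real.cos (Real.pi / m))) • (1 : A)) :
    (r * r') ^ m = (-1 : ℝ) ^ (m - 1) • (1 : A) := by
  obtain ⟨n, rfl⟩ : ∃ n, m = n + 1 := ⟨m - 1, by omega⟩
  set θ := Real.pi / (n + 1 : ℕ) with hθ
  have hpos : 0 < θ := by positivity
  have hlt : θ < Real.pi := by
    rw [hθ, div_lt_iff₀ (by positivity)]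
    have : (2 : ℝ) ≤ (n + 1 : ℕ) := by exact_mod_cast hm
    nlinarith [Real.pi_pos]
  have hs : Real.sin θ ≠ 0 := (Real.sin_pos_of_pos_of_lt_pi hpos hlt).ne'
  have hp : (r * r') * (r * r') = -(2 * Real.cos θ) • (r * r') - 1 := by
    have h1 : r' * r = (-(2 * Real.cos θ)) • (1 : A) - r * r' := by rw [← h]; abel
    calc (r * r') * (r * r') = r * (r' * r) * r' := by noncomm_ring
      _ = -(2 * Real.cos θ) • (r * r') - 1 := by
        rw [h1, mul_sub, sub_mul, mul_smul_comm, smul_mul_assoc, mul_one]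
        congr 1
        rw [← mul_assoc, hr, one_mul, hr']
  have key := mul_pow_eq_of_add_swap hp n
  have e1 : ((n : ℝ) + 1) * θ = Real.pi := by
    rw [hθ]; push_cast; field_simp
  have e2 : (n : ℝ) * θ = Real.pi - θ := by linarith
  rw [e1, e2, Real.sin_pi, Real.sin_pi_sub, zero_smul, zero_add, smul_comm] at key
  simpa using smul_right_injective A hs key

variable {B : Type*} {M : CoxeterMatrix B} {W : Type*} [Group W] (cs : CoxeterSystem M W)
  {R : B → A}

/-- The elements `R i` are unit vectors that span the angles given by the Coxeter matrix. -/
def IsRootFamily (M : CoxeterMatrix B) (R : B → A) : Prop :=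
  (∀ i, R i * R i = 1) ∧ (∀ i j, M i j ≠ 0) ∧
    ∀ i j, R i * R j + R j * R i = (-(2 * Real.cos (Real.pi / M i j))) • (1 : A)

theorem IsRootFamily.two_le (hR : IsRootFamily M R) {i j : B} (h : i ≠ j) : 2 ≤ M i j := by
  have h1 := hR.2.1 i j
  have h2 := M.off_diagonal i j h
  omega

theorem IsRootFamily.isLiftable (hR : IsRootFamily M R) :
    M.IsLiftable fun i => reflection (R i) := by
  intro i j
  have hpow : ∀ (n : ℕ) (x : A), ((reflection (R i) * reflection (R j)) ^ n) x =
      (R i * R j) ^ n * x * (R j * R i) ^ n := by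
    intro n
    induction n with
    | zero => simp
    | succ n ih =>
      intro x
      rw [pow_succ, Module.End.mul_apply, ih, Module.End.mul_apply, reflection_apply,
        reflection_apply, pow_succ (R i * R j), pow_succ' (R j * R i)]
      noncomm_ring
  ext x
  rw [hpow]
  rcases eq_or_ne i j with rfl | hij
  · simp [hR.1]
  · rw [mul_pow_eq_neg_one_pow (hR.two_le hij) (hR.1 i) (hR.1 j) (hR.2.2 i j)]
    rw [M.symmetric i j, mul_pow_eq_neg_one_pow (hR.two_le hij.symm) (hR.1 j) (hR.1 i)
      (hR.2.2 j i)]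
    -- The sign occurs once on each side of `x`, so it squares to one.
    rw [smul_mul_assoc, one_mul, smul_mul_smul_comm, ← mul_pow]
    simp

/-- The geometric representation of the Coxeter group. -/
def rep (hR : IsRootFamily M R) : W →* Module.End ℝ A := cs.lift ⟨_, hR.isLiftable⟩

theorem rep_simple (hR : IsRootFamily M R) (i : B) (x : A) :
    rep cs hR (cs.simple i) x = -(R i * x * R i) := by
  rw [rep, cs.lift_apply_simple, reflection_apply]

theorem rep_simple_root (hR : IsRootFamily M R) (i j : B) :
    rep cs hR (cs.simple i) (R j) = R j + (2 * Real.cos (Real.pi / M i j)) • R i := by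
  have h1 : R i * R j = (-(2 * Real.cos (Real.pi / M i j))) • (1 : A) - R j * R i := by
    rw [← hR.2.2 i j]; abel
  rw [rep_simple, h1, sub_mul, mul_assoc, hR.1 i, smul_mul_assoc, one_mul, mul_one]
  module

theorem rep_simple_self (hR : IsRootFamily M R) (i : B) :
    rep cs hR (cs.simple i) (R i) = -R i := by
  rw [rep_simple, hR.1, one_mul]

/-- The alternating word rotates `R i` in the plane of `R i` and `R j`. After division by `sin
(π/m)`, both coefficients are non-negative as long as k < m; this is the dihedral case of the
positivity of roots. -/
theorem rep_alternatingWord (hR : IsRootFamily M R) (i j : B) (k : ℕ) :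
    Real.sin (Real.pi / M i j) •
        rep cs hR (cs.wordProd (CoxeterSystem.alternatingWord i j k)) (R i) =
      Real.sin ((k + 1) * (Real.pi / M i j)) • R (if Even k then i else j) +
        Real.sin (k * (Real.pi / M i j)) • R (if Even k then j else i) := by
  induction k with
  | zero => simp [CoxeterSystem.alternatingWord]
  | succ k ih =>
    set θ := Real.pi / M i j with hθ
    have h2 : Real.sin ((k + 1 + 1) * θ) = 2 * Real.cos θ * Real.sin ((k + 1) * θ)
        - Real.sin (k * θ) := by
      have e1 : ((k : ℝ) + 1 + 1) * θ = (k + 1) * θ + θ := by ring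
      have e2 : (k : ℝ) * θ = (k + 1) * θ - θ := by ring
      rw [e1, e2, Real.sin_add, Real.sin_sub]; ring
    rw [CoxeterSystem.alternatingWord_succ', cs.wordProd_cons, map_mul, Module.End.mul_apply,
      ← map_smul, ih, map_add, map_smul, map_smul, rep_simple_self, rep_simple_root]
    push_cast
    rw [h2]
    rcases Nat.even_or_odd k with hk | hk
    · simp only [hk, if_true, Nat.even_add_one, not_true_eq_false, if_false]
      rw [M.symmetric j i, ← hθ]
      module
    · simp only [Nat.not_even_iff_odd.2 hk, if_false, Nat.even_add_one, not_false_eq_true, if_true]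
      rw [← hθ]
      module

/-- This is the decomposition along cosets of the dihedral subgroup of `i` and `j`: letters `j`,
`i`, `j`, … are stripped from the right until neither is a descent. The last clause guarantees
progress in the induction on length. -/
theorem exists_eq_mul_alternatingWord (n : ℕ) : ∀ (w : W) (i j : B), cs.length w = n →
    ¬ cs.IsRightDescent w i → ∃ (k : ℕ) (v : W),
      w = v * cs.wordProd (CoxeterSystem.alternatingWord i j k) ∧
      cs.length w = cs.length v + k ∧ ¬ cs.IsRightDescent v i ∧ ¬ cs.IsRightDescent v j ∧
      (cs.IsRightDescent w j → k ≠ 0) := by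
  induction n with
  | zero =>
    intro w i j hw hi
    refine ⟨0, w, by simp [CoxeterSystem.alternatingWord], rfl, hi, ?_, ?_⟩
    all_goals intro h; exact absurd h (by simp [CoxeterSystem.IsRightDescent, hw])
  | succ n ih =>
    intro w i j hw hi
    by_cases hj : cs.IsRightDescent w j
    · have hl : cs.length (w * cs.simple j) = n := by
        have := cs.isRightDescent_iff.1 hj; omega
      obtain ⟨k, v, h1, h2, h3, h4, -⟩ := ih (w * cs.simple j) j i hl
        (cs.isRightDescent_iff_not_isRightDescent_mul.1 hj)
      refine ⟨k + 1, v, ?_, by omega, h4, h3, fun _ => by omega⟩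
      rw [CoxeterSystem.alternatingWord_succ, cs.wordProd_concat, ← mul_assoc, ← h1,
        cs.simple_mul_simple_cancel_right]
    · exact ⟨0, w, by simp [CoxeterSystem.alternatingWord], rfl, hi, hj, fun h => absurd h hj⟩

theorem alternatingWord_add (i j : B) (m d : ℕ) :
    ∃ l : List B, l.length = d ∧ CoxeterSystem.alternatingWord i j (m + d) =
      l ++ CoxeterSystem.alternatingWord i j m := by
  induction d with
  | zero => exact ⟨[], by simp⟩
  | succ d ih =>
    obtain ⟨l, h1, h2⟩ := ih
    refine ⟨(if Even (m + d) then j else i) :: l, by simp [h1], ?_⟩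
    rw [← add_assoc, CoxeterSystem.alternatingWord_succ', h2, List.cons_append]

/-- An alternating word of length at least `M i j` ends in a full braid word, which can be rewritten
to end in `i`; then `i` would be a descent. -/
theorem lt_of_not_isRightDescent (hM : ∀ i j, M i j ≠ 0) {w v : W} {i j : B} {k : ℕ}
    (hi : ¬ cs.IsRightDescent w i)
    (h : w = v * cs.wordProd (CoxeterSystem.alternatingWord i j k))
    (hl : cs.length w = cs.length v + k) : k < M i j := by
  by_contra! hk
  obtain ⟨d, rfl⟩ := Nat.exists_eq_add_of_le hk
  obtain ⟨l, hd, hl'⟩ := alternatingWord_add i j (M i j) d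
  apply hi
  obtain ⟨m, hm⟩ : ∃ m, M i j = m + 1 := ⟨M i j - 1, by have := hM i j; omega⟩
  have hb : cs.wordProd (CoxeterSystem.alternatingWord i j (M i j)) =
      cs.wordProd (CoxeterSystem.alternatingWord i j m) * cs.simple i := by
    have := cs.wordProd_braidWord_eq i j
    rw [CoxeterSystem.braidWord, CoxeterSystem.braidWord, M.symmetric j i] at this
    rw [this, hm, CoxeterSystem.alternatingWord_succ, cs.wordProd_concat]
  have hw : w * cs.simple i =
      v * cs.wordProd (l ++ CoxeterSystem.alternatingWord i j m) := by
    rw [h, hl', cs.wordProd_append, cs.wordProd_append, hb]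
    simp only [mul_assoc, cs.simple_mul_simple_self, mul_one]
  have h1 := cs.length_mul_le v (cs.wordProd (l ++ CoxeterSystem.alternatingWord i j m))
  have h2 := cs.length_wordProd_le (l ++ CoxeterSystem.alternatingWord i j m)
  rw [List.length_append, CoxeterSystem.length_alternatingWord, hd] at h2
  rw [CoxeterSystem.IsRightDescent, hw]
  omega

/-- An element of the Coxeter group maps the root of an ascent to a positive root. -/
theorem rep_root_nonneg (hR : IsRootFamily M R) (L : A →ₗ[ℝ] ℝ) (hL : ∀ i, 0 ≤ L (R i)) (w : W)
    (i : B) (hi : ¬ cs.IsRightDescent w i) : 0 ≤ L (rep cs hR w (R i)) := by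
  induction hn : cs.length w using Nat.strong_induction_on generalizing w i with
  | _ n ih =>
    rcases eq_or_ne w 1 with rfl | hw
    · simpa using hL i
    obtain ⟨j, hj⟩ := cs.exists_rightDescent_of_ne_one hw
    have hij : i ≠ j := by rintro rfl; exact hi hj
    -- Since `j` is a descent, `v` is strictly shorter than `w` and has neither `i` nor `j` as a
    -- descent. Thus `w` maps `R i` to a non-negative combination of the images of `R i` and `R j`
    -- under `v`.
    obtain ⟨k, v, h1, h2, h3, h4, h5⟩ := exists_eq_mul_alternatingWord cs n w i j hn hi
    have hk := h5 hj
    have hkm := lt_of_not_isRightDescent cs hR.2.1 hi h1 h2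
    have hv : ∀ x ∈ ({i, j} : Set B), 0 ≤ L (rep cs hR v (R x)) := by
      rintro x (rfl | rfl)
      · exact ih _ (by omega) v _ h3 rfl
      · exact ih _ (by omega) v _ h4 rfl
    have hm : (2 : ℝ) ≤ M i j := by exact_mod_cast hR.two_le hij
    have hθ : 0 < Real.pi / M i j := by positivity
    have hsin : ∀ x : ℝ, 0 ≤ x → x ≤ M i j → 0 ≤ Real.sin (x * (Real.pi / M i j)) := by
      intro x h0 hx
      apply Real.sin_nonneg_of_nonneg_of_le_pi (by positivity)
      calc x * (Real.pi / M i j) ≤ M i j * (Real.pi / M i j) := by gcongr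
        _ = Real.pi := by field_simp
    have hs : 0 < Real.sin (Real.pi / M i j) := by
      apply Real.sin_pos_of_pos_of_lt_pi hθ
      rw [div_lt_iff₀ (by positivity)]
      nlinarith [Real.pi_pos]
    have key : Real.sin (Real.pi / M i j) * L (rep cs hR w (R i)) =
        Real.sin ((k + 1) * (Real.pi / M i j)) * L (rep cs hR v (R (if Even k then i else j))) +
        Real.sin (k * (Real.pi / M i j)) * L (rep cs hR v (R (if Even k then j else i))) := by
      rw [h1, map_mul, Module.End.mul_apply, ← smul_eq_mul, ← map_smul, ← map_smul,
        rep_alternatingWord, map_add, map_smul, map_smul, map_add, map_smul, map_smul, smul_eq_mul,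
        smul_eq_mul]
    have hk1 : (k : ℝ) + 1 ≤ M i j := by exact_mod_cast hkm
    have e1 := mul_nonneg (hsin (k + 1) (by positivity) hk1)
      (hv (if Even k then i else j) (by split_ifs <;> simp))
    have e2 := mul_nonneg (hsin k (by positivity) (by linarith))
      (hv (if Even k then j else i) (by split_ifs <;> simp))
    exact nonneg_of_mul_nonneg_right (by rw [key]; positivity) hs

theorem rep_root_nonpos (hR : IsRootFamily M R) (L : A →ₗ[ℝ] ℝ) (hL : ∀ i, 0 ≤ L (R i)) (w : W)
    (i : B) (hi : cs.IsRightDescent w i) : L (rep cs hR w (R i)) ≤ 0 := by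
  have h := rep_root_nonneg cs hR L hL (w * cs.simple i) i
    (cs.isRightDescent_iff_not_isRightDescent_mul.1 hi)
  rw [map_mul, Module.End.mul_apply, rep_simple_self, map_neg, map_neg] at h
  linarith

end Reflection

/-! ### The chamber of traceless matrices -/

section Chamber

open Matrix

variable {B : Type*} {M : CoxeterMatrix B} {W : Type*} [Group W] (cs : CoxeterSystem M W)
  {R : B → Matrix (Fin 2) (Fin 2) ℝ}

/-- Traceless 2×2 matrices satisfy `X r + r X = tr (X r)`, so orthogonality to `r` means
anticommuting with it: `X` lies on the mirror. -/
theorem neg_mul_mul_of_trace_eq_zero {X r : Matrix (Fin 2) (Fin 2) ℝ} (hX : X.trace = 0)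
    (hr : r * r = 1) (hr0 : r.trace = 0) (h : (X * r).trace = 0) : -(r * X * r) = X := by
  have h1 : r * X = -(X * r) := by
    rw [Matrix.trace_fin_two] at hX hr0 h
    have e1 : X 1 1 = -X 0 0 := by linarith
    have e2 : r 1 1 = -r 0 0 := by linarith
    simp only [Matrix.mul_apply, Fin.sum_univ_two, e1, e2] at h
    ext i j
    fin_cases i <;> fin_cases j <;>
      simp [Matrix.mul_apply, Fin.sum_univ_two, e1, e2] <;> linarith
  rw [h1, neg_mul, neg_neg, mul_assoc, hr, mul_one]

/-- By cyclicity of the trace each generator is self-adjoint for the trace form, so the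
representation preserves this form. -/
theorem trace_rep_mul (hR : IsRootFamily M R) (w : W) (X Y : Matrix (Fin 2) (Fin 2) ℝ) :
    (rep cs hR w X * Y).trace = (X * rep cs hR w⁻¹ Y).trace := by
  induction w using cs.simple_induction_left generalizing Y with
  | one => simp
  | mul_simple_left w i ih =>
    rw [map_mul, Module.End.mul_apply, _root_.mul_inv_rev, cs.inv_simple, map_mul, Module.End.mul_apply,
      ← ih, rep_simple, rep_simple, neg_mul, mul_neg, Matrix.trace_neg, Matrix.trace_neg]
    congr 1
    rw [mul_assoc, mul_assoc, Matrix.trace_mul_comm]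
    simp only [mul_assoc]

/-- The linear functional `Y ↦ tr (X Y)`. -/
def traceMul (X : Matrix (Fin 2) (Fin 2) ℝ) : Matrix (Fin 2) (Fin 2) ℝ →ₗ[ℝ] ℝ :=
  Matrix.traceLinearMap (Fin 2) ℝ ℝ ∘ₗ LinearMap.mulLeft ℝ X

theorem traceMul_apply (X Y : Matrix (Fin 2) (Fin 2) ℝ) : traceMul X Y = (X * Y).trace := rfl

/-- The closed fundamental chamber. -/
def chamber (R : B → Matrix (Fin 2) (Fin 2) ℝ) : Set (Matrix (Fin 2) (Fin 2) ℝ) :=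
  {X | X.trace = 0 ∧ ∀ i, 0 ≤ (X * R i).trace}

/-- The closed chamber meets every orbit at most once, and the stabilizers are parabolic. -/
theorem rep_eq_self_of_mem_chamber (hR : IsRootFamily M R) (hR0 : ∀ i, (R i).trace = 0) (w : W)
    {X : Matrix (Fin 2) (Fin 2) ℝ} (hX : X ∈ chamber R) (hwX : rep cs hR w X ∈ chamber R) :
    rep cs hR w X = X ∧ w ∈ Subgroup.closure (cs.simple '' {i | (X * R i).trace = 0}) := by
  induction hn : cs.length w using Nat.strong_induction_on generalizing w with
  | _ n ih =>
    rcases eq_or_ne w 1 with rfl | hw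
    · simp
    obtain ⟨i, hi⟩ := cs.exists_leftDescent_of_ne_one hw
    -- A left descent `i` puts the image of `X` on the non-positive side of mirror `i`, the chamber
    -- on the non-negative side. The image therefore lies on the mirror, and the shorter element
    -- obtained by removing `i` maps `X` to the same place.
    have h1 := rep_root_nonpos cs hR (traceMul X) hX.2 w⁻¹ i (cs.isRightDescent_inv_iff.2 hi)
    rw [traceMul_apply, ← trace_rep_mul] at h1
    have h2 : (rep cs hR w X * R i).trace = 0 := le_antisymm h1 (hwX.2 i)
    have h3 : rep cs hR (cs.simple i * w) X = rep cs hR w X := by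
      rw [map_mul, Module.End.mul_apply, rep_simple]
      exact neg_mul_mul_of_trace_eq_zero hwX.1 (hR.1 i) (hR0 i) h2
    have hl : cs.length (cs.simple i * w) < n := by rw [← hn]; exact hi
    obtain ⟨h4, h5⟩ := ih _ hl (cs.simple i * w) (by rwa [h3]) rfl
    have h6 : rep cs hR w X = X := by rw [← h3, h4]
    refine ⟨h6, ?_⟩
    rw [h6] at h2
    have := Subgroup.mul_mem _ (Subgroup.subset_closure (mem_image_of_mem cs.simple h2)) h5
    rwa [cs.simple_mul_simple_cancel_left] at this

end Chamber

/-! ### Points of the upper half-plane as traceless matrices -/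

section Points

open Matrix

/-- The real matrix with eigenvector `(z, 1)` for the eigenvalue `i`. -/
def ptMatrix (z : ℍ) : Matrix (Fin 2) (Fin 2) ℝ :=
  !![z.re / z.im, -(z.re ^ 2 + z.im ^ 2) / z.im; 1 / z.im, -z.re / z.im]

theorem ptMatrix_trace (z : ℍ) : (ptMatrix z).trace = 0 := by
  rw [ptMatrix, Matrix.trace_fin_two_of]; ring

theorem ptMatrix_injective : Function.Injective ptMatrix := by
  intro z w h
  have h1 := congrFun (congrFun h 1) 0
  have h2 := congrFun (congrFun h 0) 0
  simp only [ptMatrix, Matrix.of_apply, Matrix.cons_val', Matrix.cons_val_zero,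
    Matrix.cons_val_one, Matrix.cons_val_fin_one, one_div, _root_.inv_inj] at h1 h2
  have hw := w.im_pos.ne'
  rw [h1] at h2
  field_simp at h2
  exact UpperHalfPlane.ext_re_im h2 h1

/-- A real matrix is determined by one non-real eigenvector and its eigenvalue. Equivariance then
needs no explicit conjugation: `γ` maps `(z, 1)` to a multiple of `(γ z, 1)`. -/
theorem mulVec_ptMatrix_iff (z : ℍ) (X : Matrix (Fin 2) (Fin 2) ℝ) :
    X.map Complex.ofReal *ᵥ ![(z : ℂ), 1] = Complex.I • ![(z : ℂ), 1] ↔ X = ptMatrix z := by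
  have hz := z.im_pos.ne'
  have h0 : (X.map Complex.ofReal *ᵥ ![(z : ℂ), 1] = Complex.I • ![(z : ℂ), 1]) ↔
      ((X 0 0 * z.re + X 0 1 = -z.im ∧ X 0 0 * z.im = z.re) ∧
        (X 1 0 * z.re + X 1 1 = 0 ∧ X 1 0 * z.im = 1)) := by
    rw [funext_iff, Fin.forall_fin_two]
    simp [Matrix.mulVec, dotProduct, Fin.sum_univ_two, Complex.ext_iff]
  rw [h0]
  constructor
  · rintro ⟨⟨h1, h2⟩, h3, h4⟩
    ext i j
    fin_cases i <;> fin_cases j <;> simp [ptMatrix] <;> field_simp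
    · exact h2
    · have : X 0 1 = -z.im - X 0 0 * z.re := by linarith
      rw [this, ← h2]; ring
    · exact h4
    · have : X 1 1 = - X 1 0 * z.re := by linarith
      rw [this]; linear_combination (-z.re) * h4
  · rintro rfl
    simp [ptMatrix]
    field_simp
    simp

theorem ptMatrix_smul (γ : SL(2, ℝ)) (z : ℍ) :
    ptMatrix (γ • z) = γ * ptMatrix z * (γ⁻¹ : SL(2, ℝ)) := by
  symm
  rw [← mulVec_ptMatrix_iff]
  set G : Matrix (Fin 2) (Fin 2) ℂ := (γ : Matrix (Fin 2) (Fin 2) ℝ).map Complex.ofReal with hG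
  set D : ℂ := γ 1 0 * z + γ 1 1 with hD
  have hD0 : D ≠ 0 := by
    have := UpperHalfPlane.denom_ne_zero (γ : GL (Fin 2) ℝ) z
    simpa [UpperHalfPlane.denom] using this
  have hw : ((γ • z : ℍ) : ℂ) = (γ 0 0 * z + γ 0 1) / D := by
    rw [UpperHalfPlane.coe_specialLinearGroup_apply]; rfl
  have h1 : ![((γ • z : ℍ) : ℂ), 1] = D⁻¹ • (G *ᵥ ![(z : ℂ), 1]) := by
    rw [hw]
    ext i
    fin_cases i
    · simp [hG, div_eq_inv_mul]
    · simp [hG, ← hD, hD0]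
  have hmap : ∀ X Y : Matrix (Fin 2) (Fin 2) ℝ, (X * Y).map Complex.ofReal =
      X.map Complex.ofReal * Y.map Complex.ofReal := fun X Y =>
    Matrix.map_mul (f := Complex.ofRealHom)
  have hinv : ((γ⁻¹ : SL(2, ℝ)) : Matrix (Fin 2) (Fin 2) ℝ).map Complex.ofReal * G = 1 := by
    rw [hG, ← hmap, ← Matrix.SpecialLinearGroup.coe_mul, inv_mul_cancel]
    exact Matrix.map_one (f := Complex.ofReal) (by simp) (by simp)
  have hz := (mulVec_ptMatrix_iff z _).2 rfl
  rw [h1, Matrix.mulVec_smul, hmap, hmap, Matrix.mulVec_mulVec, Matrix.mul_assoc, hinv,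
    Matrix.mul_one, ← hG, ← Matrix.mulVec_mulVec, hz, Matrix.mulVec_smul, smul_comm]

/-- The point `i e^s`. -/
def axisPt (s : ℝ) : ℍ := ⟨⟨0, Real.exp s⟩, Real.exp_pos s⟩

@[simp] theorem axisPt_re (s : ℝ) : (axisPt s).re = 0 := rfl

@[simp] theorem axisPt_im (s : ℝ) : (axisPt s).im = Real.exp s := rfl

theorem axisPt_zero : axisPt 0 = I := by
  apply UpperHalfPlane.ext_re_im <;> simp

theorem ptMatrix_axisPt (s : ℝ) : ptMatrix (axisPt s) = !![0, -Real.exp s; Real.exp (-s), 0] := by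
  have : Real.exp s ≠ 0 := (Real.exp_pos s).ne'
  ext i j
  fin_cases i <;> fin_cases j <;>
    simp [ptMatrix, Real.exp_neg]
  field_simp

theorem dist_axisPt (s t : ℝ) : dist (axisPt s) (axisPt t) = |s - t| := by
  rw [UpperHalfPlane.dist_of_re_eq (by simp)]
  simp [Real.dist_eq]

theorem continuous_axisPt : Continuous axisPt := by
  have : Isometry axisPt := Isometry.of_dist_eq fun s t => by rw [dist_axisPt, Real.dist_eq]
  exact this.continuous

/-- A point at distance `|s|` from `i` and `|t - s|` from `i e^t` is `i e^s`, for `0 ≤ s`. -/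
theorem eq_axisPt_of_dist {z : ℍ} {s t : ℝ} (hs : 0 ≤ s)
    (h1 : dist I z = s) (h2 : dist z (axisPt t) = t - s) : z = axisPt s := by
  -- The function `log im` is 1-Lipschitz for the hyperbolic distance, so equality in the triangle
  -- inequality fixes the height; the formula for `cosh dist` then forces the real part to vanish.
  have him : Real.log z.im = s := by
    have e1 := UpperHalfPlane.dist_log_im_le I z
    have e2 := UpperHalfPlane.dist_log_im_le z (axisPt t)
    rw [h1, Real.dist_eq] at e1
    rw [h2, Real.dist_eq] at e2
    simp only [I_im, axisPt_im, Real.log_one, Real.log_exp, zero_sub, abs_neg] at e1 e2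
    have e3 := (abs_le.1 e1).2
    have e4 := (abs_le.1 e2).1
    linarith
  have him' : z.im = Real.exp s := by rw [← him, Real.exp_log z.im_pos]
  refine UpperHalfPlane.ext_re_im ?_ him'
  have h3 : Real.cosh (dist I z) = Real.cosh (dist I (axisPt s)) := by
    rw [h1, ← axisPt_zero, dist_axisPt, zero_sub, abs_neg, abs_of_nonneg hs]
  rw [UpperHalfPlane.cosh_dist', UpperHalfPlane.cosh_dist', him'] at h3
  have := Real.exp_pos s
  simp only [I_re, I_im, axisPt_re, axisPt_im] at h3 ⊢
  field_simp at h3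
  nlinarith

end Points

/-! ### The reflection group of the fundamental triangle -/

section Triangle

open Matrix

variable (g : ℕ) [Nat.AtLeastTwo g]

theorem two_le_genus : 2 ≤ g := Nat.AtLeastTwo.prop

/-- The angle `π / 4g`. -/
def angle : ℝ := Real.pi / (4 * g)

theorem angle_pos : 0 < angle g := by
  have := two_le_genus g
  unfold angle; positivity

theorem angle_lt : angle g < Real.pi / 4 := by
  have hg : (2 : ℝ) ≤ g := by exact_mod_cast two_le_genus g
  unfold angle
  apply div_lt_div_of_pos_left Real.pi_pos <;> linarith

theorem sin_angle_pos : 0 < Real.sin (angle g) :=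
  Real.sin_pos_of_pos_of_lt_pi (angle_pos g) (by linarith [angle_lt g, Real.pi_pos])

theorem sin_angle_lt_cos : Real.sin (angle g) < Real.cos (angle g) := by
  rw [← Real.cos_pi_div_two_sub]
  apply Real.cos_lt_cos_of_nonneg_of_le_pi_div_two <;>
    linarith [angle_lt g, angle_pos g, Real.pi_pos]

theorem stretch_eq : stretch g = (Real.cos (angle g) + √(Real.cos (2 * angle g))) /
    Real.sin (angle g) := by
  have : 2 * angle g = Real.pi / (2 * g) := by unfold angle; ring
  rw [this, stretch, angle]

theorem one_lt_stretch : 1 < stretch g := by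
  rw [stretch_eq, one_lt_div (sin_angle_pos g)]
  linarith [sin_angle_lt_cos g, Real.sqrt_nonneg (Real.cos (2 * angle g))]

/-- This is where the value of `a` matters: it is a root of `x² - 2 cot(π/4g) x + 1`, which makes
the third angle of the triangle π/4g. -/
theorem sin_mul_stretch_add_inv :
    Real.sin (angle g) * (stretch g + (stretch g)⁻¹) = 2 * Real.cos (angle g) := by
  have hs := sin_angle_pos g
  have h0 := sin_angle_lt_cos g
  have h1 : 0 ≤ Real.cos (2 * angle g) := by
    apply Real.cos_nonneg_of_neg_pi_div_two_le_of_le <;>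
      linarith [angle_lt g, angle_pos g, Real.pi_pos]
  have h2 := Real.sq_sqrt h1
  rw [Real.cos_two_mul] at h2
  have h3 := Real.sin_sq_add_cos_sq (angle g)
  rw [stretch_eq, Real.cos_two_mul]
  set r := √(2 * Real.cos (angle g) ^ 2 - 1)
  have hr : 0 ≤ r := Real.sqrt_nonneg _
  have : Real.cos (angle g) + r ≠ 0 := by linarith
  field_simp
  nlinarith

/-- The translation length of the generators. -/
def edgeLength : ℝ := 2 * Real.log (stretch g)

theorem edgeLength_pos : 0 < edgeLength g := by
  have := Real.log_pos (one_lt_stretch g)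
  unfold edgeLength; linarith

theorem exp_half_edgeLength : Real.exp (edgeLength g / 2) = stretch g := by
  rw [edgeLength, mul_div_cancel_left₀ _ (by norm_num), Real.exp_log (stretch_pos g)]

/-- The Coxeter matrix of the triangle with angles `π / 4g`, `π / 4g`, `π / 2`. -/
def triangleMatrix : CoxeterMatrix (Fin 3) where
  M := !![1, 4 * g, 2; 4 * g, 1, 4 * g; 2, 4 * g, 1]
  isSymm := by ext i j; fin_cases i <;> fin_cases j <;> rfl
  diagonal i := by fin_cases i <;> rfl
  off_diagonal i j h := by
    fin_cases i <;> fin_cases j <;> simp at h ⊢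

/-- Unit normal vectors of the sides of the triangle. -/
def triangleRoot : Fin 3 → Matrix (Fin 2) (Fin 2) ℝ :=
  ![!![1, 0; 0, -1],
    !![-Real.cos (angle g), -Real.sin (angle g); -Real.sin (angle g), Real.cos (angle g)],
    !![0, stretch g; (stretch g)⁻¹, 0]]

theorem triangleRoot_zero : triangleRoot g 0 = !![1, 0; 0, -1] := rfl

theorem triangleRoot_one : triangleRoot g 1 =
    !![-Real.cos (angle g), -Real.sin (angle g); -Real.sin (angle g), Real.cos (angle g)] := rfl

theorem triangleRoot_two : triangleRoot g 2 = !![0, stretch g; (stretch g)⁻¹, 0] := rfl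

theorem triangleMatrix_zero_one : triangleMatrix g 0 1 = 4 * g := rfl
theorem triangleMatrix_one_two : triangleMatrix g 1 2 = 4 * g := rfl
theorem triangleMatrix_zero_two : triangleMatrix g 0 2 = 2 := rfl

theorem trace_triangleRoot (i : Fin 3) : (triangleRoot g i).trace = 0 := by
  fin_cases i <;> simp [triangleRoot, Matrix.trace_fin_two_of]

theorem triangleRoot_mul_self (i : Fin 3) : triangleRoot g i * triangleRoot g i = 1 := by
  have h := Real.sin_sq_add_cos_sq (angle g)
  have hs := (stretch_pos g).ne'
  fin_cases i
  · simp [triangleRoot, Matrix.one_fin_two]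
  · simp only [triangleRoot, Matrix.one_fin_two, Fin.mk_one, Matrix.cons_val_one,
      Matrix.cons_val_zero, Matrix.mul_fin_two]
    congr! 4 <;> first | linarith | (congr! 2; linarith)
  · simp [triangleRoot, Matrix.one_fin_two, hs]

theorem isRootFamily_triangle : IsRootFamily (triangleMatrix g) (triangleRoot g) := by
  have key : ∀ i j, triangleRoot g i * triangleRoot g j + triangleRoot g j * triangleRoot g i =
      (-(2 * Real.cos (Real.pi / triangleMatrix g i j))) •
        (1 : Matrix (Fin 2) (Fin 2) ℝ) →
      triangleRoot g j * triangleRoot g i + triangleRoot g i * triangleRoot g j =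
      (-(2 * Real.cos (Real.pi / triangleMatrix g j i))) •
        (1 : Matrix (Fin 2) (Fin 2) ℝ) := by
    intro i j h
    rw [add_comm, h, (triangleMatrix g).symmetric i j]
  have hd : ∀ i, triangleRoot g i * triangleRoot g i + triangleRoot g i * triangleRoot g i =
      (-(2 * Real.cos (Real.pi / triangleMatrix g i i))) •
        (1 : Matrix (Fin 2) (Fin 2) ℝ) := by
    intro i
    rw [triangleRoot_mul_self, (triangleMatrix g).diagonal i]
    simp [two_smul, ← two_mul]
  have h01 : triangleRoot g 0 * triangleRoot g 1 + triangleRoot g 1 * triangleRoot g 0 =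
      (-(2 * Real.cos (Real.pi / triangleMatrix g 0 1))) •
        (1 : Matrix (Fin 2) (Fin 2) ℝ) := by
    rw [triangleRoot_zero, triangleRoot_one, triangleMatrix_zero_one]
    have : Real.pi / ((4 * g : ℕ) : ℝ) = angle g := by rw [angle]; push_cast; rfl
    rw [this]
    ext i j
    fin_cases i <;> fin_cases j <;> simp <;> ring
  have h02 : triangleRoot g 0 * triangleRoot g 2 + triangleRoot g 2 * triangleRoot g 0 =
      (-(2 * Real.cos (Real.pi / triangleMatrix g 0 2))) •
        (1 : Matrix (Fin 2) (Fin 2) ℝ) := by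
    rw [triangleRoot_zero, triangleRoot_two, triangleMatrix_zero_two]
    ext i j
    fin_cases i <;> fin_cases j <;> simp
  have h12 : triangleRoot g 1 * triangleRoot g 2 + triangleRoot g 2 * triangleRoot g 1 =
      (-(2 * Real.cos (Real.pi / triangleMatrix g 1 2))) •
        (1 : Matrix (Fin 2) (Fin 2) ℝ) := by
    rw [triangleRoot_one, triangleRoot_two, triangleMatrix_one_two]
    have : Real.pi / ((4 * g : ℕ) : ℝ) = angle g := by rw [angle]; push_cast; rfl
    rw [this]
    have h3 := sin_mul_stretch_add_inv g
    ext i j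
    fin_cases i <;> fin_cases j <;> simp <;> linarith
  refine ⟨triangleRoot_mul_self g, ?_, ?_⟩
  · have := two_le_genus g
    intro i j
    fin_cases i <;> fin_cases j <;> simp [triangleMatrix] <;> omega
  · intro i j
    fin_cases i <;> fin_cases j
    · exact hd _
    · exact h01
    · exact h02
    · exact key _ _ h01
    · exact hd _
    · exact h12
    · exact key _ _ h02
    · exact key _ _ h12
    · exact hd _

/-- The reflection group of the triangle. -/
abbrev TriangleGroup : Type := (triangleMatrix g).Group

/-- The Coxeter system of the reflection group of the triangle. -/
abbrev triangleSystem : CoxeterSystem (triangleMatrix g) (TriangleGroup g) :=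
  (triangleMatrix g).toCoxeterSystem

/-- The reflection in a side of the triangle. -/
abbrev side (i : Fin 3) : TriangleGroup g := (triangleSystem g).simple i

/-- The action of the reflection group on matrices. -/
abbrev triangleRep : TriangleGroup g →* Module.End ℝ (Matrix (Fin 2) (Fin 2) ℝ) :=
  rep (triangleSystem g) (isRootFamily_triangle g)

/-- The images of the three reflections under `dihedralChar`. -/
def dihedralGen : Fin 3 → DihedralGroup (4 * g) := ![.sr 0, .sr 1, .sr (2 * g : ℕ)]

/-- Every rotation is killed by the power 4g, and the product for the right angle is the rotation
with index 2g, of order two. The index records a direction among the 4g edges at a vertex. -/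
theorem dihedralGen_isLiftable : (triangleMatrix g).IsLiftable (dihedralGen g) := by
  have hr : ∀ k : ZMod (4 * g), (DihedralGroup.r k) ^ (4 * g) = 1 := by
    intro k
    rw [DihedralGroup.r_pow]
    simp
  have h2 : ∀ k : ZMod (4 * g), k * 2 = 0 → (DihedralGroup.r k) ^ 2 = 1 := by
    intro k hk
    rw [DihedralGroup.r_pow, Nat.cast_ofNat, hk]; rfl
  have h4 : (2 * g : ZMod (4 * g)) * 2 = 0 := by
    have := ZMod.natCast_self (4 * g)
    push_cast at this
    rw [← this]; ring
  intro i j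
  fin_cases i <;> fin_cases j <;> simp [dihedralGen, triangleMatrix, hr, h2, h4]

/-- A character of the reflection group that is trivial on the surface group. -/
def dihedralChar : TriangleGroup g →* DihedralGroup (4 * g) :=
  (triangleSystem g).lift ⟨_, dihedralGen_isLiftable g⟩

theorem dihedralChar_side (i : Fin 3) : dihedralChar g (side g i) = dihedralGen g i :=
  (triangleSystem g).lift_apply_simple (dihedralGen_isLiftable g) i

/-! ### Stabilizers -/

theorem mem_closure_pair {G : Type*} [Group G] {s t : G} (hs : s * s = 1) (ht : t * t = 1) {w : G}
    (hw : w ∈ Subgroup.closure {s, t}) : ∃ n : ℤ, w = (s * t) ^ n ∨ w = s * (s * t) ^ n := by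
  have hst : ∀ n : ℤ, t * (s * t) ^ n = s * (s * t) ^ (n + 1) := by
    intro n
    rw [add_comm, _root_.zpow_add, zpow_one, ← mul_assoc, ← mul_assoc, hs, one_mul]
  have hst' : ∀ n : ℤ, t * (s * (s * t) ^ n) = (s * t) ^ (n - 1) := by
    intro n
    rw [sub_eq_neg_add, _root_.zpow_add, _root_.zpow_neg_one, _root_.mul_inv_rev, inv_eq_of_mul_eq_one_left hs,
      inv_eq_of_mul_eq_one_left ht, mul_assoc]
  have step : ∀ x ∈ ({s, t} : Set G), ∀ y,
      (∃ n : ℤ, y = (s * t) ^ n ∨ y = s * (s * t) ^ n) →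
      ∃ n : ℤ, x * y = (s * t) ^ n ∨ x * y = s * (s * t) ^ n := by
    rintro x (rfl | rfl) y ⟨n, rfl | rfl⟩
    · exact ⟨n, Or.inr rfl⟩
    · exact ⟨n, Or.inl (by rw [← mul_assoc, hs, one_mul])⟩
    · exact ⟨n + 1, Or.inr (hst n)⟩
    · exact ⟨n - 1, Or.inl (hst' n)⟩
  induction hw using Subgroup.closure_induction_left with
  | one => exact ⟨0, by simp⟩
  | mul_left x hx y hy ih => exact step x hx y ih
  | inv_mul_cancel x hx y hy ih =>
    have : x⁻¹ = x := by
      rcases hx with rfl | rfl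
      · exact inv_eq_of_mul_eq_one_left hs
      · exact inv_eq_of_mul_eq_one_left ht
    rw [this]
    exact step x hx y ih

theorem r_zpow {n : ℕ} (k : ZMod n) (z : ℤ) :
    (DihedralGroup.r k) ^ z = DihedralGroup.r ((z : ZMod n) * k) := by
  cases z with
  | ofNat z =>
    rw [Int.ofNat_eq_natCast, zpow_natCast, DihedralGroup.r_pow, mul_comm]; simp
  | negSucc z =>
    rw [zpow_negSucc, DihedralGroup.r_pow, DihedralGroup.inv_r, mul_comm]; simp; ring

/-- The rotation `side 0 * side j` is mapped to the rotation with this index. -/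
def dihedralStep : Fin 3 → ℕ := ![0, 1, 2 * g]

/-- In the normal form of a dihedral group, words of odd length go to reflections, so an element
sent to a rotation is a power of `side 0 * side j`. The degenerate case j = 0, with a single
generating reflection, serves for generic points of an edge. -/
theorem dihedralChar_of_mem_closure {j : Fin 3} {w : TriangleGroup g}
    (hw : w ∈ Subgroup.closure {side g 0, side g j}) {k : ZMod (4 * g)}
    (hk : dihedralChar g w = .r k) :
    ∃ n : ℤ, w = (side g 0 * side g j) ^ n ∧
      dihedralGen g 0 * dihedralGen g j = .r (dihedralStep g j : ZMod (4 * g)) ∧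
      k = n * (dihedralStep g j : ZMod (4 * g)) := by
  have h0 : dihedralGen g 0 * dihedralGen g j = .r (dihedralStep g j : ZMod (4 * g)) := by
    fin_cases j <;> simp [dihedralGen, dihedralStep]
  obtain ⟨n, h | h⟩ := mem_closure_pair ((triangleSystem g).simple_mul_simple_self 0)
    ((triangleSystem g).simple_mul_simple_self j) hw
  · refine ⟨n, h, h0, ?_⟩
    rw [h, map_zpow, map_mul, dihedralChar_side, dihedralChar_side, h0, r_zpow] at hk
    simpa using hk.symm
  · exfalso
    rw [h, map_mul, map_zpow, map_mul, dihedralChar_side, dihedralChar_side, h0, r_zpow] at hk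
    simp [dihedralGen] at hk

/-- The rotations in the stabilizers of `i` and of the midpoint have orders 4g and 2, and so do
their images. The kernel therefore meets these stabilizers trivially. -/
theorem eq_one_of_dihedralChar_eq_one {j : Fin 3} {w : TriangleGroup g}
    (hw : w ∈ Subgroup.closure {side g 0, side g j}) (h : dihedralChar g w = 1) : w = 1 := by
  rw [DihedralGroup.one_def] at h
  obtain ⟨n, h1, -, h2⟩ := dihedralChar_of_mem_closure g hw h
  have hdvd : (triangleMatrix g 0 j : ℤ) ∣ n := by
    have hg := two_le_genus g
    fin_cases j
    · exact one_dvd n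
    · exact (ZMod.intCast_zmod_eq_zero_iff_dvd n (4 * g)).1 (by simpa [dihedralStep] using h2.symm)
    · have h3 : (((n * (2 * g : ℕ) : ℤ)) : ZMod (4 * g)) = 0 := by
        push_cast
        simpa [dihedralStep] using h2.symm
      have := (ZMod.intCast_zmod_eq_zero_iff_dvd _ (4 * g)).1 h3
      have h4 : ((4 * g : ℕ) : ℤ) = 2 * (2 * g : ℕ) := by push_cast; ring
      rw [h4] at this
      exact Int.dvd_of_mul_dvd_mul_right (by positivity) this
  obtain ⟨c, rfl⟩ := hdvd
  rw [h1, _root_.zpow_mul, zpow_natCast, (triangleSystem g).simple_mul_simple_pow, _root_.one_zpow]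

end Triangle

/-! ### The surface group as a subgroup of the reflection group -/

section SurfaceGroup

open Matrix

/-- The matrix of a rotation about `i`. -/
def rotA (t : ℝ) : SL(2, ℝ) :=
  ⟨!![Real.cos t, Real.sin t; -Real.sin t, Real.cos t], by
    rw [Matrix.det_fin_two_of]; nlinarith [Real.sin_sq_add_cos_sq t]⟩

theorem coe_rotA (t : ℝ) : (rotA t : Matrix (Fin 2) (Fin 2) ℝ) =
    !![Real.cos t, Real.sin t; -Real.sin t, Real.cos t] := rfl

theorem rotA_add (s t : ℝ) : rotA (s + t) = rotA s * rotA t := by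
  ext i j
  rw [Matrix.SpecialLinearGroup.coe_mul, coe_rotA, coe_rotA, coe_rotA, Real.cos_add, Real.sin_add]
  fin_cases i <;> fin_cases j <;> simp <;> ring

theorem rotA_zero : rotA 0 = 1 := by
  ext i j
  rw [coe_rotA]
  fin_cases i <;> fin_cases j <;> simp

theorem rotA_pow (t : ℝ) (n : ℕ) : rotA t ^ n = rotA (n * t) := by
  induction n with
  | zero => simp [rotA_zero]
  | succ n ih => rw [pow_succ, ih, ← rotA_add]; congr 1; push_cast; ring

/-- The half-turn about `i`. -/
def turnI : SL(2, ℝ) := rotA (Real.pi / 2)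

theorem coe_turnI : (turnI : Matrix (Fin 2) (Fin 2) ℝ) = !![0, 1; -1, 0] := by
  rw [turnI, coe_rotA]; simp

theorem smul_axisPt {γ : SL(2, ℝ)} {s t : ℝ}
    (h : (γ : Matrix (Fin 2) (Fin 2) ℝ) * ptMatrix (axisPt s) = ptMatrix (axisPt t) * γ) :
    γ • axisPt s = axisPt t := by
  apply ptMatrix_injective
  rw [ptMatrix_smul, h, Matrix.mul_assoc, ← Matrix.SpecialLinearGroup.coe_mul, mul_inv_cancel,
    Matrix.SpecialLinearGroup.coe_one, Matrix.mul_one]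

theorem rotA_smul_I (t : ℝ) : rotA t • I = I := by
  rw [← axisPt_zero]
  apply smul_axisPt
  rw [coe_rotA, ptMatrix_axisPt]
  ext i j
  fin_cases i <;> fin_cases j <;> simp

theorem turnI_smul_axisPt (s : ℝ) : turnI • axisPt s = axisPt (-s) := by
  apply smul_axisPt
  rw [coe_turnI, ptMatrix_axisPt, ptMatrix_axisPt]
  ext i j
  fin_cases i <;> fin_cases j <;> simp

variable (g : ℕ) [Nat.AtLeastTwo g]

/-- The half-turn about the midpoint of the segment from `i` to `Q_g i`. -/
def turnMid : SL(2, ℝ) :=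
  ⟨!![0, stretch g; -(stretch g)⁻¹, 0], by
    rw [Matrix.det_fin_two_of]; simp [(stretch_pos g).ne']⟩

theorem coe_turnMid : (turnMid g : Matrix (Fin 2) (Fin 2) ℝ) =
    !![0, stretch g; -(stretch g)⁻¹, 0] := rfl

theorem coe_transQ : (transQ g : Matrix (Fin 2) (Fin 2) ℝ) =
    !![stretch g, 0; 0, (stretch g)⁻¹] := rfl

/-- A translation is a product of two half-turns, here about `i` and about the midpoint of the edge.
Both half-turns come from the reflection group. -/
theorem transQ_eq : transQ g * turnI = turnMid g := by
  ext i j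
  rw [Matrix.SpecialLinearGroup.coe_mul, coe_turnMid, coe_turnI, coe_transQ]
  fin_cases i <;> fin_cases j <;> simp

theorem transQ_smul_axisPt (s : ℝ) : transQ g • axisPt s = axisPt (s + edgeLength g) := by
  apply smul_axisPt
  have h1 : Real.exp (s + edgeLength g) = Real.exp s * stretch g ^ 2 := by
    rw [← exp_half_edgeLength, ← Real.exp_nat_mul, ← Real.exp_add]; congr 1; push_cast; ring
  have hs := (stretch_pos g).ne'
  have he := (Real.exp_pos s).ne'
  rw [coe_transQ, ptMatrix_axisPt, ptMatrix_axisPt, Real.exp_neg, Real.exp_neg, h1]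
  ext i j
  fin_cases i <;> fin_cases j <;> simp <;> field_simp

theorem turnMid_smul_axisPt (s : ℝ) : turnMid g • axisPt s = axisPt (edgeLength g - s) := by
  rw [← transQ_eq, mul_smul, turnI_smul_axisPt, transQ_smul_axisPt]; congr 1; ring

/-- The matrix `γ` acts by conjugation as the element `w` of the reflection group. -/
def ActsAs (γ : SL(2, ℝ)) (w : TriangleGroup g) : Prop :=
  ∀ X, triangleRep g w X = γ * X * (γ⁻¹ : SL(2, ℝ))

variable {g}

theorem ActsAs.one : ActsAs g 1 1 := by intro X; simp

theorem ActsAs.mul {γ γ' : SL(2, ℝ)} {w w' : TriangleGroup g} (h : ActsAs g γ w)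
    (h' : ActsAs g γ' w') : ActsAs g (γ * γ') (w * w') := by
  intro X
  rw [map_mul, Module.End.mul_apply, h', h, _root_.mul_inv_rev, Matrix.SpecialLinearGroup.coe_mul,
    Matrix.SpecialLinearGroup.coe_mul]
  simp only [Matrix.mul_assoc]

theorem ActsAs.inv {γ : SL(2, ℝ)} {w : TriangleGroup g} (h : ActsAs g γ w) :
    ActsAs g γ⁻¹ w⁻¹ := by
  intro X
  have hX : X = triangleRep g w ((γ⁻¹ : SL(2, ℝ)) * X * γ) := by
    rw [h, Matrix.mul_assoc, Matrix.mul_assoc, ← Matrix.SpecialLinearGroup.coe_mul, mul_inv_cancel,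
      ← Matrix.mul_assoc, ← Matrix.mul_assoc, ← Matrix.SpecialLinearGroup.coe_mul, mul_inv_cancel,
      Matrix.SpecialLinearGroup.coe_one, Matrix.one_mul, Matrix.mul_one]
  conv_lhs => rw [hX]
  rw [← Module.End.mul_apply, ← map_mul, inv_mul_cancel, map_one, Module.End.one_apply, inv_inv]

theorem ActsAs.pow {γ : SL(2, ℝ)} {w : TriangleGroup g} (h : ActsAs g γ w) (n : ℕ) :
    ActsAs g (γ ^ n) (w ^ n) := by
  induction n with
  | zero => simpa using ActsAs.one
  | succ n ih => rw [pow_succ, pow_succ]; exact ih.mul h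

theorem ActsAs.ptMatrix {γ : SL(2, ℝ)} {w : TriangleGroup g} (h : ActsAs g γ w) (z : ℍ) :
    triangleRep g w (ptMatrix z) = ptMatrix (γ • z) := by
  rw [h, ptMatrix_smul]

theorem ActsAs.smul_eq {γ : SL(2, ℝ)} (h : ActsAs g γ 1) (z : ℍ) : γ • z = z := by
  apply ptMatrix_injective
  rw [← h.ptMatrix, map_one, Module.End.one_apply]

/-- The signs of the two reflections cancel, and a scalar `c = ±1` disappears under conjugation. -/
theorem actsAs_of_root_mul {γ : SL(2, ℝ)} {i j : Fin 3} {c : ℝ} (hc : c * c = 1)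
    (h : triangleRoot g i * triangleRoot g j = c • (γ : Matrix (Fin 2) (Fin 2) ℝ))
    (h' : triangleRoot g j * triangleRoot g i =
      c • ((γ⁻¹ : SL(2, ℝ)) : Matrix (Fin 2) (Fin 2) ℝ)) :
    ActsAs g γ (side g i * side g j) := by
  intro X
  have : triangleRep g (side g i * side g j) X =
      (triangleRoot g i * triangleRoot g j) * X * (triangleRoot g j * triangleRoot g i) := by
    rw [map_mul, Module.End.mul_apply, rep_simple, rep_simple]
    noncomm_ring
  rw [this, h, h', smul_mul_assoc, smul_mul_smul_comm, hc, one_smul]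

variable (g)

theorem actsAs_rot : ActsAs g (rotA (angle g)) (side g 0 * side g 1) := by
  apply actsAs_of_root_mul (c := -1) (by norm_num)
  · rw [triangleRoot_zero, triangleRoot_one, coe_rotA]
    ext i j
    fin_cases i <;> fin_cases j <;> simp
  · rw [triangleRoot_zero, triangleRoot_one, Matrix.SpecialLinearGroup.coe_inv, coe_rotA,
      Matrix.adjugate_fin_two_of]
    ext i j
    fin_cases i <;> fin_cases j <;> simp

theorem actsAs_turnMid : ActsAs g (turnMid g) (side g 0 * side g 2) := by
  apply actsAs_of_root_mul (c := 1) (by norm_num)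
  · rw [triangleRoot_zero, triangleRoot_two, coe_turnMid]
    ext i j
    fin_cases i <;> fin_cases j <;> simp
  · rw [triangleRoot_zero, triangleRoot_two, Matrix.SpecialLinearGroup.coe_inv, coe_turnMid,
      Matrix.adjugate_fin_two_of]
    ext i j
    fin_cases i <;> fin_cases j <;> simp

theorem dihedralChar_rot : dihedralChar g (side g 0 * side g 1) = .r 1 := by
  rw [map_mul, dihedralChar_side, dihedralChar_side]; simp [dihedralGen]

theorem dihedralChar_turnMid : dihedralChar g (side g 0 * side g 2) = .r (2 * g : ℕ) := by
  rw [map_mul, dihedralChar_side, dihedralChar_side]; simp [dihedralGen]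

/-- The angle θ is the multiple (2g-1)·π/4g of the basic angle, so `M_g` acts as an element of the
reflection group. -/
theorem rotA_pow_eq_rotM : rotA (angle g) ^ (2 * g - 1) = rotM g := by
  have hg := two_le_genus g
  rw [rotA_pow]
  have : ((2 * g - 1 : ℕ) : ℝ) * angle g = (2 * g - 1) * Real.pi / (4 * g) := by
    rw [Nat.cast_sub (by omega), angle]; push_cast; ring
  rw [this]
  rfl

theorem rotA_pow_eq_turnI : rotA (angle g) ^ (2 * g) = turnI := by
  have hg := two_le_genus g
  rw [rotA_pow, turnI]
  congr 1
  rw [angle]; push_cast; field_simp; norm_num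

theorem exists_actsAs_turnI :
    ∃ w, ActsAs g turnI w ∧ dihedralChar g w = .r ((2 * g : ℕ) : ZMod (4 * g)) := by
  refine ⟨_, rotA_pow_eq_turnI g ▸ (actsAs_rot g).pow (2 * g), ?_⟩
  rw [map_pow, dihedralChar_rot, DihedralGroup.r_pow, one_mul]

theorem exists_actsAs_rotM_pow (n : ℕ) : ∃ w, ActsAs g ((rotM g ^ n)⁻¹) w ∧
    dihedralChar g w = .r (-(((2 * g - 1 : ℕ) : ZMod (4 * g)) * n)) := by
  refine ⟨_, rotA_pow_eq_rotM g ▸ (((actsAs_rot g).pow (2 * g - 1)).pow n).inv, ?_⟩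
  rw [map_inv, map_pow, map_pow, dihedralChar_rot, DihedralGroup.r_pow, DihedralGroup.r_pow,
    one_mul, DihedralGroup.inv_r]

/-- The half-turns about `i` and about the midpoint have the same image, the rotation with index 2g,
which cancels in their quotient. -/
theorem exists_actsAs_transQ : ∃ w, ActsAs g (transQ g) w ∧ dihedralChar g w = 1 := by
  obtain ⟨w, hw, h⟩ := exists_actsAs_turnI g
  refine ⟨_, eq_mul_inv_of_mul_eq (transQ_eq g) ▸ (actsAs_turnMid g).mul hw.inv, ?_⟩
  rw [map_mul, dihedralChar_turnMid, map_inv, h, mul_inv_cancel]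

/-- The elements of the surface group lie in the kernel of the character. -/
theorem exists_actsAs {γ : SL(2, ℝ)} (hγ : γ ∈ surfaceGroup g) :
    ∃ w, ActsAs g γ w ∧ dihedralChar g w = 1 := by
  induction hγ using Subgroup.closure_induction with
  | mem x hx =>
    obtain ⟨j, -, rfl⟩ := hx
    obtain ⟨w, hw, -⟩ := exists_actsAs_rotM_pow g j
    obtain ⟨q, hq, h⟩ := exists_actsAs_transQ g
    have := (hw.mul hq).mul hw.inv
    rw [inv_inv] at this
    refine ⟨_, this, ?_⟩
    rw [map_mul, map_mul, map_inv, h, mul_one, mul_inv_cancel]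
  | one => exact ⟨1, ActsAs.one, map_one _⟩
  | mul x y _ _ hx hy =>
    obtain ⟨w, hw, h⟩ := hx
    obtain ⟨w', hw', h'⟩ := hy
    exact ⟨_, hw.mul hw', by rw [map_mul, h, h', one_mul]⟩
  | inv x _ hx =>
    obtain ⟨w, hw, h⟩ := hx
    exact ⟨_, hw.inv, by rw [map_inv, h, inv_one]⟩

/-! ### The edges -/

variable {g}

/-- The rotation about `i` that maps the positive imaginary axis to the edge of the letter. -/
def spoke (a : Letter g) : SL(2, ℝ) :=
  (rotM g ^ ((a.1 : ℕ) + 1))⁻¹ * if a.2 then 1 else turnI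

/-- The angle of the edge of a letter, in units of `π / 2g`. -/
def spokeIndex (a : Letter g) : ZMod (4 * g) :=
  -(((2 * g - 1 : ℕ) : ZMod (4 * g)) * ((a.1 : ℕ) + 1 : ℕ)) + if a.2 then 0 else (2 * g : ℕ)

/-- The geodesic from `i` to the image of `i` under the letter. -/
def edge (a : Letter g) (t : ℝ) : ℍ := spoke a • axisPt (t * edgeLength g)

theorem exists_actsAs_spoke (a : Letter g) :
    ∃ w, ActsAs g (spoke a) w ∧ dihedralChar g w = .r (spokeIndex a) := by
  obtain ⟨w, hw, h⟩ := exists_actsAs_rotM_pow g ((a.1 : ℕ) + 1)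
  obtain ⟨q, hq, h'⟩ := exists_actsAs_turnI g
  rcases a with ⟨j, b⟩
  cases b
  · exact ⟨_, hw.mul hq, by rw [map_mul, h, h']; simp [spokeIndex]⟩
  · exact ⟨_, hw.mul ActsAs.one, by rw [map_mul, h, map_one]; simp [spokeIndex]⟩

/-- The half-turn about `i` conjugates `Q_g` to its inverse, so a letter and its inverse take the
same form with opposite spokes. -/
theorem deck_eq (a : Letter g) : a.deck = spoke a * transQ g * (spoke a)⁻¹ := by
  have h : transQ g * turnI * transQ g = turnI := by
    ext i j
    rw [Matrix.SpecialLinearGroup.coe_mul, Matrix.SpecialLinearGroup.coe_mul, coe_turnI, coe_transQ]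
    fin_cases i <;> fin_cases j <;> simp [(stretch_pos g).ne']
  have h' : (transQ g)⁻¹ = turnI * transQ g * turnI⁻¹ := by
    rw [inv_eq_iff_mul_eq_one, ← mul_assoc, ← mul_assoc, h, mul_inv_cancel]
  rcases a with ⟨j, b⟩
  cases b
  · simp only [Letter.deck, spoke, delta, _root_.mul_inv_rev, inv_inv, h', Bool.false_eq_true,
      if_false, mul_assoc]
  · simp [Letter.deck, spoke, delta]

theorem Letter.deck_mem (a : Letter g) : a.deck ∈ surfaceGroup g := by
  have h : delta g ((a.1 : ℕ) + 1) ∈ surfaceGroup g := by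
    apply Subgroup.subset_closure
    refine ⟨_, ⟨by omega, ?_⟩, rfl⟩
    have := a.1.2; omega
  unfold Letter.deck
  split_ifs
  · exact h
  · exact inv_mem h

theorem edge_zero (a : Letter g) : edge a 0 = I := by
  have h : turnI • I = I := rotA_smul_I _
  have h' : ∀ n : ℕ, (rotM g ^ n)⁻¹ • I = I := by
    intro n
    rw [inv_smul_eq_iff, ← rotA_pow_eq_rotM, ← pow_mul, rotA_pow, rotA_smul_I]
  rw [edge, zero_mul, axisPt_zero, spoke, mul_smul]
  split_ifs
  · rw [one_smul, h']
  · rw [h, h']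

theorem edge_one (a : Letter g) : edge a 1 = a.deck • I := by
  have h := edge_zero a
  rw [edge, zero_mul] at h
  rw [deck_eq, ← h, mul_smul, inv_smul_smul, mul_smul, transQ_smul_axisPt, edge, one_mul, zero_add]

/-- The inverse letter points along the opposite ray at `i`; the translation by `a` moves its edge
onto the edge of `a`, run backwards. -/
theorem deck_smul_edge_inverse (a : Letter g) (t : ℝ) :
    a.deck • edge a.inverse t = edge a (1 - t) := by
  have h : ∀ s : ℝ, (spoke a)⁻¹ • spoke a.inverse • axisPt s = axisPt (-s) := by
    intro s
    rw [inv_smul_eq_iff]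
    rcases a with ⟨j, b⟩
    cases b <;> simp [spoke, Letter.inverse, mul_smul, turnI_smul_axisPt]
  rw [deck_eq, mul_smul, mul_smul, edge, h, transQ_smul_axisPt, edge]
  congr 2; ring

theorem continuous_edge (a : Letter g) : Continuous (edge a) := by
  unfold edge
  exact (continuous_axisPt.comp (continuous_id.mul continuous_const)).const_smul _

theorem dist_edge (a : Letter g) (s t : ℝ) :
    dist (edge a s) (edge a t) = |s - t| * edgeLength g := by
  rw [edge, edge, dist_smul, dist_axisPt, ← sub_mul, abs_mul, abs_of_pos (edgeLength_pos g)]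

/-- The geodesic of constant speed is unique. -/
theorem eq_edge_of_isGeodesic {a : Letter g} {γ : ℝ → ℍ} (h : IsGeodesic γ I (a.deck • I)) {t : ℝ}
    (ht : t ∈ Icc (0 : ℝ) 1) : γ t = edge a t := by
  have hL := edgeLength_pos g
  obtain ⟨h0, h1, h2⟩ := h
  have hd : dist I (a.deck • I) = edgeLength g := by
    rw [← edge_one, ← edge_zero a, dist_edge]; simp
  have e1 := h2 0 (by simp) t ht
  have e2 := h2 t ht 1 (by simp)
  rw [hd, h0, zero_sub, abs_neg, abs_of_nonneg ht.1] at e1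
  rw [hd, h1, abs_sub_comm, abs_of_nonneg (by linarith [ht.2])] at e2
  have hI : (spoke a)⁻¹ • I = I := by
    rw [inv_smul_eq_iff]
    have := edge_zero a
    rw [edge, zero_mul, axisPt_zero] at this
    exact this.symm
  rw [edge, ← inv_smul_eq_iff]
  apply eq_axisPt_of_dist (t := edgeLength g) (mul_nonneg ht.1 hL.le)
  · rw [← hI, dist_smul, e1]
  · have : axisPt (edgeLength g) = (spoke a)⁻¹ • a.deck • I := by
      rw [← edge_one, edge, one_mul, inv_smul_smul]
    rw [this, dist_smul, e2]; ring

/-- Since 2g-1 ≡ -1 modulo 2g, the index modulo 2g determines the generator; its two signs differ by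
2g, which is not zero modulo 4g. -/
theorem eq_of_spokeIndex_eq {a b : Letter g} (h : spokeIndex a = spokeIndex b) : a = b := by
  have hg := two_le_genus g
  rcases a with ⟨i, x⟩
  rcases b with ⟨j, y⟩
  have hcast : ∀ (k : Fin (2 * g)) (z : Bool), spokeIndex (k, z) =
      (((-((2 * g - 1) * ((k : ℕ) + 1)) + if z then 0 else 2 * g : ℤ)) : ZMod (4 * g)) := by
    intro k z
    rw [spokeIndex]
    rw [Nat.cast_sub (by omega)]
    cases z <;> push_cast <;> rfl
  rw [hcast, hcast, ZMod.intCast_eq_intCast_iff_dvd_sub] at h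
  have hi := i.2
  have hj := j.2
  have h2 : ((2 * g : ℕ) : ℤ) ∣ (j : ℤ) - i := by
    have h3 : ((2 * g : ℕ) : ℤ) ∣ ((4 * g : ℕ) : ℤ) := ⟨2, by push_cast; ring⟩
    have h4 := h3.trans h
    have h5 : (j : ℤ) - i = ((-((2 * g - 1) * ((j : ℕ) + 1)) + if y then 0 else 2 * g : ℤ) -
        (-((2 * g - 1) * ((i : ℕ) + 1)) + if x then 0 else 2 * g : ℤ)) -
        ((2 * g : ℕ) : ℤ) * (((if y then 0 else 1) - if x then 0 else 1) - (j - i)) := by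
      push_cast
      cases x <;> cases y <;> simp <;> ring
    rw [h5]
    exact dvd_sub h4 (dvd_mul_right _ _)
  have hij : (j : ℤ) - i = 0 := by
    apply Int.eq_zero_of_abs_lt_dvd h2
    rw [abs_lt]; push_cast; constructor <;> omega
  have hij' : i = j := by ext; omega
  subst hij'
  congr 1
  by_contra hxy
  have h6 : ((4 * g : ℕ) : ℤ) ∣ ((2 * g : ℕ) : ℤ) := by
    cases x <;> cases y <;> simp at hxy h ⊢
    · exact h
    · simpa using h
  have := Int.le_of_dvd (by positivity) h6
  push_cast at this
  omega

theorem spokeIndex_inverse (a : Letter g) :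
    spokeIndex a.inverse = spokeIndex a + (2 * g : ℕ) := by
  have h : ((2 * g : ℕ) : ZMod (4 * g)) + (2 * g : ℕ) = 0 := by
    rw [← Nat.cast_add, ← ZMod.natCast_self (4 * g)]; congr 1; ring
  rcases a with ⟨j, b⟩
  cases b
  · simp only [spokeIndex, Letter.inverse, Bool.not_false, if_true, Bool.false_eq_true, if_false,
      add_assoc, h, Nat.cast_zero]
  · simp [spokeIndex, Letter.inverse]

end SurfaceGroup

/-! ### Intersections of edges -/

section Edges

open Matrix

variable {g : ℕ} [Nat.AtLeastTwo g]

theorem trace_axisPt_mul_root_zero (s : ℝ) :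
    (ptMatrix (axisPt s) * triangleRoot g 0).trace = 0 := by
  rw [ptMatrix_axisPt, triangleRoot_zero]; simp [Matrix.trace_fin_two]

theorem trace_axisPt_mul_root_one (s : ℝ) :
    (ptMatrix (axisPt s) * triangleRoot g 1).trace =
      Real.sin (angle g) * (Real.exp s - Real.exp (-s)) := by
  rw [ptMatrix_axisPt, triangleRoot_one]; simp [Matrix.trace_fin_two]; ring

theorem trace_axisPt_mul_root_two (s : ℝ) :
    (ptMatrix (axisPt s) * triangleRoot g 2).trace =
      Real.exp (edgeLength g / 2 - s) - Real.exp (-(edgeLength g / 2 - s)) := by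
  rw [neg_sub, Real.exp_sub, Real.exp_sub, ptMatrix_axisPt, triangleRoot_two,
    exp_half_edgeLength]
  simp [Matrix.trace_fin_two, Real.exp_neg]
  ring

theorem axisPt_mem_chamber {s : ℝ} (h0 : 0 ≤ s) (h1 : s ≤ edgeLength g / 2) :
    ptMatrix (axisPt s) ∈ chamber (triangleRoot g) := by
  refine ⟨ptMatrix_trace _, fun i => ?_⟩
  fin_cases i
  · exact (trace_axisPt_mul_root_zero s).ge
  · rw [Fin.mk_one, trace_axisPt_mul_root_one]
    exact mul_nonneg (sin_angle_pos g).le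
      (sub_nonneg.2 (Real.exp_le_exp.2 (by linarith)))
  · change 0 ≤ (ptMatrix (axisPt s) * triangleRoot g 2).trace
    rw [trace_axisPt_mul_root_two]
    exact sub_nonneg.2 (Real.exp_le_exp.2 (by linarith))

/-- The stabilizer of a point on the first half of the imaginary edge. -/
theorem closure_side_le {s : ℝ} :
    Subgroup.closure ((triangleSystem g).simple ''
        {i | (ptMatrix (axisPt s) * triangleRoot g i).trace = 0}) ≤
      Subgroup.closure {side g 0, side g (if s = 0 then 1 else
        if s = edgeLength g / 2 then 2 else 0)} := by
  -- The endpoints of the half-edge lie on one further side each. At all other points the second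
  -- generator defaults to `side 0`, which adds nothing but keeps the two-generator shape.
  apply Subgroup.closure_mono
  rintro _ ⟨i, hi, rfl⟩
  have hs := (sin_angle_pos g).ne'
  have hL := edgeLength_pos g
  fin_cases i
  · exact Or.inl rfl
  · right
    simp only [Fin.mk_one, mem_ofPred_eq, trace_axisPt_mul_root_one, mul_eq_zero, hs, false_or,
      sub_eq_zero, Real.exp_eq_exp] at hi
    have : s = 0 := by linarith
    rw [mem_singleton_iff, if_pos this]; rfl
  · right
    have hi' : (ptMatrix (axisPt s) * triangleRoot g 2).trace = 0 := hi
    rw [trace_axisPt_mul_root_two, sub_eq_zero, Real.exp_eq_exp] at hi'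
    have h1 : s = edgeLength g / 2 := by linarith
    have h2 : s ≠ 0 := by linarith
    rw [mem_singleton_iff, if_neg h2, if_pos h1]; rfl

/-- The first half of an edge, or the second half reversed. -/
theorem exists_fold (a : Letter g) {t : ℝ} (ht : t ∈ Icc (0 : ℝ) 1) :
    ∃ (h : SL(2, ℝ)) (w : TriangleGroup g) (e : ℕ) (s : ℝ),
      edge a t = h • axisPt (s * edgeLength g) ∧ ActsAs g h w ∧
      dihedralChar g w = .r (spokeIndex a + (e * (2 * g) : ℕ)) ∧ 0 ≤ s ∧ s ≤ 1 / 2 ∧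
      (e = 0 ∧ t = s ∨ e = 1 ∧ t = 1 - s) := by
  obtain ⟨w, hw, hc⟩ := exists_actsAs_spoke a
  rcases le_total t (1 / 2) with h | h
  · exact ⟨spoke a, w, 0, t, rfl, hw, by simp [hc], ht.1, h, by simp⟩
  -- The half-turn about the midpoint exchanges the halves of an edge; `e` counts its uses.
  · refine ⟨_, _, 1, 1 - t, ?_, hw.mul (actsAs_turnMid g), ?_, by linarith [ht.2], by linarith,
      Or.inr ⟨rfl, by ring⟩⟩
    · rw [mul_smul, turnMid_smul_axisPt, edge]
      congr 2; ring
    · rw [map_mul, hc, dihedralChar_turnMid, one_mul, DihedralGroup.r_mul_r]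

theorem actsAs_fold {h h' γ : SL(2, ℝ)} {x y : ℍ} {w w' v : TriangleGroup g} (hw : ActsAs g h w)
    (hw' : ActsAs g h' w') (hv : ActsAs g γ v) (heq : γ • h • x = h' • y) :
    triangleRep g (w'⁻¹ * (v * w)) (ptMatrix x) = ptMatrix y := by
  rw [(hw'.inv.mul (hv.mul hw)).ptMatrix, mul_smul, mul_smul, heq, inv_smul_smul]

theorem half_mul_edgeLength_iff {s : ℝ} : s * edgeLength g = edgeLength g / 2 ↔ s = 1 / 2 := by
  have hL := (edgeLength_pos g).ne'
  constructor
  · intro h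
    have : s * edgeLength g = 1 / 2 * edgeLength g := by rw [h]; ring
    exact mul_right_cancel₀ hL this
  · rintro rfl; ring

/-- Two edges of the tessellation intersect only in common vertices, unless they coincide. -/
theorem edge_eq_edge {γ : SL(2, ℝ)} (hγ : γ ∈ surfaceGroup g) {a b : Letter g} {t t' : ℝ}
    (ht : t ∈ Icc (0 : ℝ) 1) (ht' : t' ∈ Icc (0 : ℝ) 1) (heq : γ • edge a t = edge b t') :
    ((t = 0 ∨ t = 1) ∧ (t' = 0 ∨ t' = 1)) ∨ (a = b ∧ t = t') ∨ (a = b.inverse ∧ t = 1 - t') := by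
  have hL := edgeLength_pos g
  obtain ⟨v, hv, hχ⟩ := exists_actsAs g hγ
  obtain ⟨h, w, e, s, he, hw, hc, hs0, hs1, hcase⟩ := exists_fold a ht
  obtain ⟨h', w', e', s', he', hw', hc', hs0', hs1', hcase'⟩ := exists_fold b ht'
  rw [he, he'] at heq
  have key := actsAs_fold hw hw' hv heq
  have hbd : ∀ r : ℝ, 0 ≤ r → r ≤ 1 / 2 →
      0 ≤ r * edgeLength g ∧ r * edgeLength g ≤ edgeLength g / 2 := fun r h0 h1 =>
    ⟨by positivity, by nlinarith⟩
  have hmem := axisPt_mem_chamber (hbd s hs0 hs1).1 (hbd s hs0 hs1).2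
  have hmem' := axisPt_mem_chamber (hbd s' hs0' hs1').1 (hbd s' hs0' hs1').2
  -- Both folded points lie in the chamber and in one orbit, so they coincide, and the element
  -- relating them lies in the stabilizer.
  obtain ⟨h1, h2⟩ := rep_eq_self_of_mem_chamber (triangleSystem g) (isRootFamily_triangle g)
    (trace_triangleRoot g) (w'⁻¹ * (v * w)) hmem (by rw [key]; exact hmem')
  rw [key] at h1
  have hss : s' = s := by
    have := congrArg UpperHalfPlane.im (ptMatrix_injective h1)
    rw [axisPt_im, axisPt_im, Real.exp_eq_exp] at this
    exact mul_right_cancel₀ hL.ne' this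
  subst hss
  rcases eq_or_ne s' 0 with rfl | hs
  · left
    constructor
    · rcases hcase with ⟨-, h⟩ | ⟨-, h⟩ <;> simp [h]
    · rcases hcase' with ⟨-, h⟩ | ⟨-, h⟩ <;> simp [h]
  right
  have h3 := closure_side_le h2
  rw [if_neg (mul_ne_zero hs hL.ne')] at h3
  -- As `γ` has trivial character, only the difference of the two directions remains, each corrected
  -- by 2g if its half-edge was reversed.
  have hr : dihedralChar g (w'⁻¹ * (v * w)) = .r (-(spokeIndex b + (e' * (2 * g) : ℕ)) +
      (spokeIndex a + (e * (2 * g) : ℕ))) := by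
    rw [map_mul, map_inv, map_mul, hχ, hc, hc', one_mul, DihedralGroup.inv_r, DihedralGroup.r_mul_r]
  obtain ⟨n, -, -, hn⟩ := dihedralChar_of_mem_closure g h3 hr
  have h4g : ((2 * g : ℕ) : ZMod (4 * g)) + (2 * g : ℕ) = 0 := by
    rw [← Nat.cast_add, ← ZMod.natCast_self (4 * g)]; congr 1; ring
  have hinv := spokeIndex_inverse b
  -- The stabilizer of the midpoint contains the half-turn, so there the directions agree only
  -- modulo 2g: the letters are equal or inverse, and t = t' = 1/2 suits both.
  by_cases hhalf : s' = 1 / 2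
  · have htt : t = 1 / 2 := by rcases hcase with ⟨-, h⟩ | ⟨-, h⟩ <;> rw [h, hhalf]; norm_num
    have htt' : t' = 1 / 2 := by rcases hcase' with ⟨-, h⟩ | ⟨-, h⟩ <;> rw [h, hhalf]; norm_num
    rw [if_pos (half_mul_edgeLength_iff.2 hhalf)] at hn
    have hmul : ∀ k : ℤ, (k : ZMod (4 * g)) * (2 * g : ℕ) = 0 ∨
        (k : ZMod (4 * g)) * (2 * g : ℕ) = (2 * g : ℕ) := by
      intro k
      rcases Int.even_or_odd' k with ⟨c, rfl | rfl⟩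
      · left; push_cast at h4g ⊢; linear_combination (c : ZMod (4 * g)) * h4g
      · right; push_cast at h4g ⊢; linear_combination (c : ZMod (4 * g)) * h4g
    have hd : spokeIndex a - spokeIndex b = ((n + e' - e : ℤ) : ZMod (4 * g)) * (2 * g : ℕ) := by
      have : (dihedralStep g 2 : ZMod (4 * g)) = (2 * g : ℕ) := rfl
      rw [this] at hn
      push_cast at hn ⊢
      linear_combination hn
    rcases hmul (n + e' - e) with h0 | h0
    · left
      rw [h0, sub_eq_zero] at hd
      exact ⟨eq_of_spokeIndex_eq hd, by rw [htt, htt']⟩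
    · right
      rw [h0] at hd
      exact ⟨eq_of_spokeIndex_eq (by rw [hinv]; linear_combination hd), by rw [htt, htt']; norm_num⟩
  -- Elsewhere the only rotation in the stabilizer is the identity, so the corrected directions
  -- agree exactly. The reversals `e` and `e'` decide between equal and inverse letters.
  · rw [if_neg (half_mul_edgeLength_iff.not.2 hhalf)] at hn
    have hn' : spokeIndex a + (e * (2 * g) : ℕ) = spokeIndex b + (e' * (2 * g) : ℕ) := by
      have : (dihedralStep g 0 : ZMod (4 * g)) = 0 := by simp [dihedralStep]
      rw [this, mul_zero] at hn
      linear_combination hn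
    rcases hcase with ⟨rfl, rfl⟩ | ⟨rfl, rfl⟩ <;> rcases hcase' with ⟨rfl, rfl⟩ | ⟨rfl, rfl⟩
    · left; exact ⟨eq_of_spokeIndex_eq (by simpa using hn'), rfl⟩
    · right; exact ⟨eq_of_spokeIndex_eq (by rw [hinv]; simpa using hn'), by ring⟩
    · right
      refine ⟨eq_of_spokeIndex_eq ?_, by ring⟩
      rw [hinv]
      push_cast at hn' h4g ⊢
      linear_combination hn' - h4g
    · left; exact ⟨eq_of_spokeIndex_eq (by simpa using hn'), rfl⟩

/-- The surface group acts freely on the orbits of the points of the edges. -/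
theorem smul_eq_of_edge {γ : SL(2, ℝ)} (hγ : γ ∈ surfaceGroup g) {a : Letter g} {t : ℝ}
    (ht : t ∈ Icc (0 : ℝ) 1) (heq : γ • edge a t = edge a t) (z : ℍ) : γ • z = z := by
  have hL := edgeLength_pos g
  obtain ⟨v, hv, hχ⟩ := exists_actsAs g hγ
  obtain ⟨h, w, e, s, he, hw, hc, hs0, hs1, hcase⟩ := exists_fold a ht
  rw [he] at heq
  have key := actsAs_fold hw hw hv heq
  have hmem : ptMatrix (axisPt (s * edgeLength g)) ∈ chamber (triangleRoot g) :=
    axisPt_mem_chamber (by positivity) (by nlinarith)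
  obtain ⟨-, h2⟩ := rep_eq_self_of_mem_chamber (triangleSystem g) (isRootFamily_triangle g)
    (trace_triangleRoot g) (w⁻¹ * (v * w)) hmem (by rw [key]; exact hmem)
  have h3 : w⁻¹ * (v * w) = 1 := by
    refine eq_one_of_dihedralChar_eq_one g (closure_side_le h2) ?_
    rw [map_mul, map_mul, map_inv, hχ, one_mul, inv_mul_cancel]
  have h4 : v = 1 := mul_eq_right.1 (_root_.inv_mul_eq_one.1 h3).symm
  exact ActsAs.smul_eq (h4 ▸ hv) z

/-! ### Discreteness -/

/-- No non-trivial element of the reflection group maps an interior point of the triangle into the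
closed triangle, so a ball inside the open triangle works. -/
theorem exists_ball_free (g : ℕ) [Nat.AtLeastTwo g] : ∃ (c : ℍ) (ε : ℝ), 0 < ε ∧
    ∀ γ ∈ surfaceGroup g, dist (γ • c) c < ε → ∀ z : ℍ, γ • z = z := by
  set U : Set ℍ := {z | ∀ i, 0 < (ptMatrix z * triangleRoot g i).trace} with hU
  have hopen : IsOpen U := by
    rw [hU, ofPred_forall]
    apply isOpen_iInter_of_finite
    intro i
    apply isOpen_lt continuous_const
    have : Continuous ptMatrix := by
      refine continuous_matrix fun i j => ?_
      have h1 := UpperHalfPlane.continuous_re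
      have h2 := UpperHalfPlane.continuous_im
      have h3 : ∀ z : ℍ, z.im ≠ 0 := fun z => z.im_pos.ne'
      fin_cases i <;> fin_cases j <;> simp only [ptMatrix] <;> simp <;> fun_prop (disch := assumption)
    exact (this.matrix_mul continuous_const).matrix_trace
  obtain ⟨c, hc⟩ : U.Nonempty := by
    have hs := sin_angle_pos g
    have hcos := sin_angle_lt_cos g
    have hcos1 := Real.cos_le_one (angle g)
    have ha := one_lt_stretch g
    set a := stretch g
    -- The point is taken on the circle `|z|² = a`, between the third mirror `|z| = a` and the unit
    -- circle, with a real part δ small enough for the second mirror: `2 δ cos(π/4g) < (a-1)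
    -- sin(π/4g)`. The bound 1/2 keeps `a - δ²` positive.
    set δ := min (1 / 2) (Real.sin (angle g) * (a - 1) / 4) with hδ
    have hδ0 : 0 < δ := lt_min (by norm_num) (by have := sub_pos.2 ha; positivity)
    have hδ1 : δ ≤ 1 / 2 := min_le_left _ _
    have hδ2 : δ ≤ Real.sin (angle g) * (a - 1) / 4 := min_le_right _ _
    have hy : 0 < √(a - δ ^ 2) := Real.sqrt_pos.2 (by nlinarith)
    have hy2 : √(a - δ ^ 2) ^ 2 = a - δ ^ 2 := Real.sq_sqrt (by nlinarith)
    set y := √(a - δ ^ 2)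
    refine ⟨⟨⟨δ, y⟩, hy⟩, fun i => ?_⟩
    have hre : (⟨⟨δ, y⟩, hy⟩ : ℍ).re = δ := rfl
    have him : (⟨⟨δ, y⟩, hy⟩ : ℍ).im = y := rfl
    have hpt : ptMatrix ⟨⟨δ, y⟩, hy⟩ = !![δ / y, -a / y; 1 / y, -δ / y] := by
      rw [ptMatrix, hre, him, hy2]; congr! 5; ring
    rw [hpt]
    fin_cases i
    · change 0 < (_ * triangleRoot g 0).trace
      rw [triangleRoot_zero]
      simp [Matrix.trace_fin_two]
      have : 0 < δ / y := by positivity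
      rw [neg_div]; linarith
    · change 0 < (_ * triangleRoot g 1).trace
      have e : (!![δ / y, -a / y; 1 / y, -δ / y] * triangleRoot g 1).trace =
          (Real.sin (angle g) * (a - 1) - 2 * Real.cos (angle g) * δ) / y := by
        rw [triangleRoot_one]
        simp [Matrix.trace_fin_two]
        ring
      rw [e]
      apply div_pos _ hy
      nlinarith
    · change 0 < (_ * triangleRoot g 2).trace
      have e : (!![δ / y, -a / y; 1 / y, -δ / y] * triangleRoot g 2).trace = (a - 1) / y := by
        rw [triangleRoot_two]
        simp [Matrix.trace_fin_two]
        have : a ≠ 0 := by linarith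
        change -a / y * a⁻¹ + y⁻¹ * a = _
        field_simp
        ring
      rw [e]
      exact div_pos (by linarith) hy
  obtain ⟨ε, hε, hball⟩ := Metric.isOpen_iff.1 hopen c hc
  refine ⟨c, ε, hε, fun γ hγ hd z => ?_⟩
  obtain ⟨v, hv, -⟩ := exists_actsAs g hγ
  have hγc : γ • c ∈ U := hball hd
  have hmem : ∀ z ∈ U, ptMatrix z ∈ chamber (triangleRoot g) := fun z hz =>
    ⟨ptMatrix_trace z, fun i => (hz i).le⟩
  obtain ⟨-, h2⟩ := rep_eq_self_of_mem_chamber (triangleSystem g) (isRootFamily_triangle g)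
    (trace_triangleRoot g) v (hmem c hc) (by rw [hv.ptMatrix]; exact hmem _ hγc)
  have h3 : {i | (ptMatrix c * triangleRoot g i).trace = 0} = ∅ := by
    ext i; simpa using (hc i).ne'
  rw [h3, image_empty, Subgroup.closure_empty, Subgroup.mem_bot] at h2
  exact ActsAs.smul_eq (h2 ▸ hv) z

/-- The orbits of the surface group are discrete. -/
theorem exists_dist_lt_imp_smul_eq (g : ℕ) [Nat.AtLeastTwo g] (z : ℍ) :
    ∃ ε > 0, ∀ γ ∈ surfaceGroup g, dist (γ • z) z < ε → γ • z = z := by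
  by_contra! hcon
  obtain ⟨c, ε, hε, hfree⟩ := exists_ball_free g
  have hpos : ∀ n : ℕ, (0 : ℝ) < 1 / (n + 1) := fun n => by positivity
  choose γ hγ hd hne using fun n : ℕ => hcon (1 / (n + 1)) (hpos n)
  -- The translates of the free point `c` stay in a compact ball, so a subsequence converges. Its
  -- late members differ by elements that act trivially, hence the translates of `z` are eventually
  -- constant along it.
  have hmem : ∀ n, γ n • c ∈ Metric.closedBall z (1 + dist z c) := by
    intro n
    rw [Metric.mem_closedBall]
    have h1 : dist (γ n • c) (γ n • z) = dist z c := by rw [dist_smul, dist_comm]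
    have h2 : (1 : ℝ) / (n + 1) ≤ 1 := by
      rw [div_le_one (by positivity)]; linarith [(Nat.cast_nonneg n : (0 : ℝ) ≤ n)]
    linarith [dist_triangle (γ n • c) (γ n • z) z, hd n]
  obtain ⟨y, -, f, hf, hlim⟩ := (isCompact_closedBall z (1 + dist z c)).tendsto_subseq hmem
  obtain ⟨N, hN⟩ := Metric.cauchySeq_iff'.1 hlim.cauchySeq ε hε
  have hconst : ∀ n ≥ N, γ (f n) • z = γ (f N) • z := by
    intro n hn
    have h1 := hN n hn
    have h2 : dist (((γ (f N))⁻¹ * γ (f n)) • c) c < ε := by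
      rw [mul_smul, ← dist_smul (γ (f N)), smul_inv_smul]; exact h1
    have := hfree _ (mul_mem (inv_mem (hγ _)) (hγ _)) h2 z
    rwa [mul_smul, inv_smul_eq_iff] at this
  have hlim0 : Filter.Tendsto (fun n => dist (γ (f n) • z) z) Filter.atTop (nhds 0) := by
    refine squeeze_zero (fun _ => dist_nonneg) (fun n => (hd (f n)).le) ?_
    exact (tendsto_one_div_add_atTop_nhds_zero_nat (𝕜 := ℝ)).comp hf.tendsto_atTop
  have hlim1 : Filter.Tendsto (fun n => dist (γ (f n) • z) z) Filter.atTop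
      (nhds (dist (γ (f N) • z) z)) := by
    apply tendsto_const_nhds.congr'
    filter_upwards [Filter.eventually_ge_atTop N] with n hn
    rw [hconst n hn]
  exact hne (f N) (dist_eq_zero.1 (tendsto_nhds_unique hlim1 hlim0))

end Edges

/-! ### Loops and their liftings -/

section Lifting

variable {g : ℕ} [Nat.AtLeastTwo g]

theorem proj_eq_iff {z w : ℍ} : proj g z = proj g w ↔ ∃ γ ∈ surfaceGroup g, γ • w = z := by
  rw [proj, proj, Quotient.eq, MulAction.orbitRel_apply, MulAction.mem_orbit_iff]
  constructor
  · rintro ⟨γ, h⟩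
    exact ⟨γ, γ.2, h⟩
  · rintro ⟨γ, hγ, h⟩
    exact ⟨⟨γ, hγ⟩, h⟩

theorem proj_smul {γ : SL(2, ℝ)} (hγ : γ ∈ surfaceGroup g) (z : ℍ) :
    proj g (γ • z) = proj g z :=
  proj_eq_iff.2 ⟨γ, hγ, rfl⟩

theorem circleCover_eq_iff {s t : ℝ} : circleCover s = circleCover t ↔ ∃ n : ℤ, s = t + n := by
  rw [circleCover, circleCover, Circle.exp_eq_exp]
  have := Real.pi_pos.ne'
  refine exists_congr fun n => ⟨fun h => ?_, fun h => by rw [h]; ring⟩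
  have h2 : (2 * Real.pi) * s = (2 * Real.pi) * (t + n) := by rw [h]; ring
  exact mul_left_cancel₀ (by positivity) h2

theorem circleCover_add_intCast (t : ℝ) (n : ℤ) : circleCover (t + n) = circleCover t :=
  circleCover_eq_iff.2 ⟨n, rfl⟩

theorem continuous_circleCover : Continuous circleCover := by
  unfold circleCover; fun_prop

theorem letterAt_natCast_add_one {m : ℕ} [NeZero m] (u : Fin m → Letter g) (k : ℤ) :
    letterAt u (k + 1) = u ⟨(k % m).toNat, by
      have hm : (0 : ℤ) < m := by exact_mod_cast NeZero.pos m
      have h1 := Int.emod_nonneg k hm.ne'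
      have h2 := Int.emod_lt_of_pos k hm
      omega⟩ := by
  simp only [letterAt, add_sub_cancel_right]

theorem letterAt_add_mul {m : ℕ} [NeZero m] (u : Fin m → Letter g) (k c : ℤ) :
    letterAt u (k + m * c) = letterAt u k := by
  have : (k + m * c - 1) % m = (k - 1) % m := by
    rw [show k + m * c - 1 = k - 1 + m * c by ring, Int.add_mul_emod_self_left]
  simp only [letterAt, this]

variable {m n : ℕ} [NeZero m] [NeZero n] {u : Fin m → Letter g} {v : Fin n → Letter g}
  {φ ψ : C(Circle, Surface g)}

theorem loop_apply (hφ : IsPiecewiseGeodesicLoop u φ) (k : ℤ) {t : ℝ} (ht : t ∈ Icc (0 : ℝ) 1) :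
    φ (circleCover ((k + t) / m)) = proj g (edge (letterAt u (k + 1)) t) := by
  have hm : (0 : ℤ) < m := by exact_mod_cast NeZero.pos m
  have hm' : (m : ℝ) ≠ 0 := by exact_mod_cast NeZero.ne m
  have h1 := Int.emod_nonneg k hm.ne'
  have h2 := Int.emod_lt_of_pos k hm
  obtain ⟨γ, hγ, h⟩ := hφ ⟨(k % m).toNat, by omega⟩
  rw [letterAt_natCast_add_one, ← eq_edge_of_isGeodesic hγ ht, ← h t ht]
  congr 1
  rw [circleCover_eq_iff]
  refine ⟨k / m, ?_⟩
  have e1 : (((k % m).toNat : ℕ) : ℝ) = ((k % m : ℤ) : ℝ) := by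
    rw [← Int.cast_natCast, Int.toNat_of_nonneg h1]
  have e2 : (k : ℝ) = ((k % m : ℤ) : ℝ) + m * ((k / m : ℤ) : ℝ) := by
    exact_mod_cast (Int.emod_add_mul_ediv k m).symm
  simp only [e1]
  rw [e2]
  field_simp
  ring

/-- This describes the graph in the surface as a wedge of circles: all endpoints project to one
vertex, and the remaining coincidences are those of an edge with itself or its reverse. -/
theorem proj_edge_eq_iff {a b : Letter g} {s t : ℝ} (hs : s ∈ Icc (0 : ℝ) 1)
    (ht : t ∈ Icc (0 : ℝ) 1) : proj g (edge a s) = proj g (edge b t) ↔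
      ((s = 0 ∨ s = 1) ∧ (t = 0 ∨ t = 1)) ∨ (a = b ∧ s = t) ∨ (a = b.inverse ∧ s = 1 - t) := by
  constructor
  · intro h
    obtain ⟨γ, hγ, h⟩ := proj_eq_iff.1 h.symm
    exact edge_eq_edge hγ hs ht h
  · have hv : ∀ (c : Letter g) (r : ℝ), r = 0 ∨ r = 1 → proj g (edge c r) = proj g I := by
      rintro c r (rfl | rfl)
      · rw [edge_zero]
      · rw [edge_one, proj_smul c.deck_mem]
    rintro (⟨h1, h2⟩ | ⟨rfl, rfl⟩ | ⟨rfl, rfl⟩)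
    · rw [hv a s h1, hv b t h2]
    · rfl
    · have := deck_smul_edge_inverse b (1 - t)
      rw [sub_sub_cancel] at this
      rw [← this, proj_smul b.deck_mem]

theorem loop_eq_loop_iff (hφ : IsPiecewiseGeodesicLoop u φ) (hψ : IsPiecewiseGeodesicLoop v ψ)
    (k l : ℤ) {s t : ℝ} (hs : s ∈ Icc (0 : ℝ) 1) (ht : t ∈ Icc (0 : ℝ) 1) :
    torusPoint m n (k + s) (l + t) ∈ cvp φ ψ ↔
      ((s = 0 ∨ s = 1) ∧ (t = 0 ∨ t = 1)) ∨ (letterAt u (k + 1) = letterAt v (l + 1) ∧ s = t) ∨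
        (letterAt u (k + 1) = (letterAt v (l + 1)).inverse ∧ s = 1 - t) := by
  rw [← proj_edge_eq_iff hs ht, ← loop_apply hφ k hs, ← loop_apply hψ l ht]
  rfl

/-! ### Uniqueness of liftings -/

theorem smul_eq_of_smul_edge {γ σ : SL(2, ℝ)} (hγ : γ ∈ surfaceGroup g) (hσ : σ ∈ surfaceGroup g)
    {a : Letter g} {t : ℝ} (ht : t ∈ Icc (0 : ℝ) 1) (h : γ • σ • edge a t = σ • edge a t) (z : ℍ) :
    γ • z = z := by
  have h1 : (σ⁻¹ * γ * σ) • edge a t = edge a t := by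
    rw [mul_smul, mul_smul, h, inv_smul_smul]
  have h2 := smul_eq_of_edge (mul_mem (mul_mem (inv_mem hσ) hγ) hσ) ht h1 (σ⁻¹ • z)
  rwa [mul_smul, mul_smul, smul_inv_smul, smul_left_cancel_iff] at h2

/-- The preimage of the image of the edges. -/
def OnEdge (g : ℕ) [Nat.AtLeastTwo g] (z : ℍ) : Prop :=
  ∃ (a : Letter g) (t : ℝ), t ∈ Icc (0 : ℝ) 1 ∧ proj g z = proj g (edge a t)

theorem OnEdge.smul_eq {γ : SL(2, ℝ)} (hγ : γ ∈ surfaceGroup g) {z : ℍ} (hz : OnEdge g z)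
    (h : γ • z = z) (x : ℍ) : γ • x = x := by
  obtain ⟨a, t, ht, he⟩ := hz
  obtain ⟨σ, hσ, rfl⟩ := proj_eq_iff.1 he
  exact smul_eq_of_smul_edge hγ hσ ht h x

/-- Unique lifting is proved on the graph only, by a clopen argument. Near a point of agreement `f'`
and `f` differ by elements that move `f t` very little; by discreteness these fix `f t`, and as `f
t` lies over an edge they act trivially. -/
theorem eqOn_of_proj_eq {S : Set ℝ} (hS : IsPreconnected S) {f f' : ℝ → ℍ} (hf : ContinuousOn f S)
    (hf' : ContinuousOn f' S) (hp : ∀ t ∈ S, proj g (f' t) = proj g (f t))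
    (he : ∀ t ∈ S, OnEdge g (f t)) {t₀ : ℝ} (ht₀ : t₀ ∈ S) (h0 : f' t₀ = f t₀) :
    EqOn f' f S := by
  have := isPreconnected_iff_preconnectedSpace.1 hS
  have hc : Continuous fun t : S => f t := continuousOn_iff_continuous_domRestrict.1 hf
  have hc' : Continuous fun t : S => f' t := continuousOn_iff_continuous_domRestrict.1 hf'
  have hclopen : IsClopen {t : S | f' t = f t} := by
    refine ⟨isClosed_eq hc' hc, ?_⟩
    rw [isOpen_iff_mem_nhds]
    rintro ⟨t, ht⟩ (heq : f' t = f t)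
    obtain ⟨ε, hε, hd⟩ := exists_dist_lt_imp_smul_eq g (f t)
    have h1 := Metric.tendsto_nhds.1 (hc.tendsto ⟨t, ht⟩) (ε / 2) (by positivity)
    have h2 := Metric.tendsto_nhds.1 (hc'.tendsto ⟨t, ht⟩) (ε / 2) (by positivity)
    filter_upwards [h1, h2] with s hs hs'
    obtain ⟨γ, hγ, h⟩ := proj_eq_iff.1 (hp s s.2)
    have h3 : dist (γ • f t) (f t) < ε := by
      have e1 : dist (γ • f t) (f' s) = dist (f s) (f t) := by rw [← h, dist_smul, dist_comm]
      rw [heq] at hs'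
      linarith [dist_triangle (γ • f t) (f' s) (f t)]
    change f' s = f s
    rw [← h, (he t ht).smul_eq hγ (hd γ hγ h3)]
  have huniv := hclopen.eq_univ ⟨⟨t₀, ht₀⟩, h0⟩
  intro t ht
  have : (⟨t, ht⟩ : S) ∈ {t : S | f' t = f t} := huniv ▸ mem_univ _
  exact this

theorem onEdge_of_isLifting (hφ : IsPiecewiseGeodesicLoop u φ) {f : ℝ → ℍ} (hf : IsLifting φ f)
    (t : ℝ) : OnEdge g (f t) := by
  have hm : (m : ℝ) ≠ 0 := by exact_mod_cast NeZero.ne m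
  refine ⟨letterAt u (⌊t * m⌋ + 1), Int.fract (t * m), ⟨Int.fract_nonneg _, (Int.fract_lt_one _).le⟩, ?_⟩
  rw [← loop_apply hφ ⌊t * m⌋ ⟨Int.fract_nonneg _, (Int.fract_lt_one _).le⟩, hf.2,
    Int.floor_add_fract, mul_div_cancel_right₀ _ hm]

theorem IsLifting.smul {f : ℝ → ℍ} (hf : IsLifting φ f) {γ : SL(2, ℝ)}
    (hγ : γ ∈ surfaceGroup g) : IsLifting φ fun t => γ • f t :=
  ⟨hf.1.const_smul γ, fun t => by rw [proj_smul hγ, hf.2]⟩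

theorem IsLifting.eq_of_eq (hφ : IsPiecewiseGeodesicLoop u φ) {f f' : ℝ → ℍ} (hf : IsLifting φ f)
    (hf' : IsLifting φ f') {t₀ : ℝ} (h : f' t₀ = f t₀) : f' = f := by
  funext t
  exact eqOn_of_proj_eq isPreconnected_univ hf.1.continuousOn hf'.1.continuousOn
    (fun t _ => by rw [hf.2, hf'.2]) (fun t _ => onEdge_of_isLifting hφ hf t) (mem_univ t₀) h
    (mem_univ t)

theorem IsLifting.exists_smul (hφ : IsPiecewiseGeodesicLoop u φ) {f f' : ℝ → ℍ}
    (hf : IsLifting φ f) (hf' : IsLifting φ f') :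
    ∃ γ ∈ surfaceGroup g, f' = fun t => γ • f t := by
  have h : proj g (f' 0) = proj g (f 0) := by rw [hf.2, hf'.2]
  obtain ⟨γ, hγ, h⟩ := proj_eq_iff.1 h
  exact ⟨γ, hγ, (hf.smul hγ).eq_of_eq hφ hf' h.symm⟩

/-! ### The standard lifting -/

theorem prefixDeck_zero (u : Fin m → Letter g) : prefixDeck u 0 = 1 := by
  simp [prefixDeck]

theorem prefixDeck_succ (u : Fin m → Letter g) (k : ℤ) :
    prefixDeck u (k + 1) = prefixDeck u k * (letterAt u (k + 1)).deck := by
  have hm : (0 : ℤ) < m := by exact_mod_cast NeZero.pos m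
  have h1 := Int.emod_nonneg k hm.ne'
  have h2 := Int.emod_lt_of_pos k hm
  set L := List.ofFn fun j => (u j).deck with hL
  have hlen : L.length = m := by simp [hL]
  have hi : (k % m).toNat < L.length := by omega
  have hstep : (L.take (k % m).toNat).prod * (letterAt u (k + 1)).deck =
      (L.take ((k % m).toNat + 1)).prod := by
    rw [List.prod_take_succ _ _ hi, letterAt_natCast_add_one]
    simp [hL]
  simp only [prefixDeck]
  rw [← hL, mul_assoc, hstep]
  -- When `k + 1` reaches a multiple of `m`, the completed prefix is absorbed into the power of the
  -- whole word.
  rcases lt_or_ge (k % m + 1) m with h | h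
  · have e1 : (k + 1) % m = k % m + 1 := by
      rw [Int.add_emod, Int.emod_eq_of_lt (a := 1) (by norm_num) (by omega),
        Int.emod_eq_of_lt (by omega) h]
    have e2 : (k + 1) / m = k / m := by
      have a1 := Int.emod_add_mul_ediv k m
      have a2 := Int.emod_add_mul_ediv (k + 1) m
      rw [e1] at a2
      have a3 : (m : ℤ) * ((k + 1) / m) = m * (k / m) := by linarith
      exact mul_left_cancel₀ hm.ne' a3
    rw [e1, e2, Int.toNat_add h1 (by norm_num)]
    rfl
  · have e0 : k % m = m - 1 := by omega
    have a1 := Int.emod_add_mul_ediv k m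
    have e3 : k + 1 = m * (k / m + 1) := by rw [mul_add]; omega
    have e4 : (k % m).toNat + 1 = L.length := by omega
    have e5 : (k + 1) / m = k / m + 1 := by
      conv_lhs => rw [e3]
      rw [Int.mul_ediv_cancel_left _ hm.ne']
    have e6 : (k + 1) % m = 0 := by rw [e3, Int.mul_emod_right]
    rw [e4, e5, e6, List.take_length, zpow_add_one]
    simp

theorem prefixDeck_mem (u : Fin m → Letter g) (k : ℤ) : prefixDeck u k ∈ surfaceGroup g := by
  induction k using Int.induction_on with
  | zero => rw [prefixDeck_zero]; exact one_mem _
  | succ k ih => rw [prefixDeck_succ]; exact mul_mem ih (Letter.deck_mem _)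
  | pred k ih =>
    have := prefixDeck_succ u (-(k : ℤ) - 1)
    rw [sub_add_cancel] at this
    rw [eq_mul_inv_iff_mul_eq.2 this.symm]
    exact mul_mem ih (inv_mem (Letter.deck_mem _))

/-- One point of agreement determines the lifting on the whole edge. The start point t₀ = 0 is used
to move forwards along the word, the end point t₀ = 1 to move backwards. -/
theorem IsStandardLifting.eqOn_edge (hφ : IsPiecewiseGeodesicLoop u φ) {f : ℝ → ℍ}
    (hf : IsLifting φ f) (k : ℤ) {t₀ : ℝ} (ht₀ : t₀ ∈ Icc (0 : ℝ) 1)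
    (h : f ((k + t₀) / m) = prefixDeck u k • edge (letterAt u (k + 1)) t₀) :
    EqOn (fun t => f ((k + t) / m)) (fun t => prefixDeck u k • edge (letterAt u (k + 1)) t)
      (Icc 0 1) := by
  refine eqOn_of_proj_eq (g := g) isPreconnected_Icc ?_ ?_ ?_ ?_ ht₀ h
  · exact ((continuous_edge _).const_smul _).continuousOn
  · exact (hf.1.comp (by fun_prop)).continuousOn
  · intro t ht
    rw [hf.2, loop_apply hφ k ht, proj_smul (prefixDeck_mem u k)]
  · intro t ht
    exact ⟨_, t, ht, proj_smul (prefixDeck_mem u k) _⟩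

theorem IsStandardLifting.apply_div (hφ : IsPiecewiseGeodesicLoop u φ) {f : ℝ → ℍ}
    (hf : IsStandardLifting φ f) (k : ℤ) : f (k / m) = prefixDeck u k • I := by
  induction k using Int.induction_on with
  | zero => simp [prefixDeck_zero, hf.2]
  | succ k ih =>
    have := eqOn_edge hφ hf.1 k (t₀ := 0) (by simp) (by rw [add_zero, ih, edge_zero])
      (show (1 : ℝ) ∈ Icc (0 : ℝ) 1 by simp)
    simp only [edge_one] at this
    rw [prefixDeck_succ, mul_smul, ← this]
    push_cast
    rfl
  | pred k ih =>
    have h1 := prefixDeck_succ u (-(k : ℤ) - 1)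
    rw [sub_add_cancel] at h1
    have := eqOn_edge hφ hf.1 (-(k : ℤ) - 1) (t₀ := 1) (by simp)
      (by rw [edge_one, ← mul_smul, sub_add_cancel, ← h1, ← ih]; push_cast; congr 2; ring)
      (show (0 : ℝ) ∈ Icc (0 : ℝ) 1 by simp)
    simp only [edge_zero, add_zero] at this
    exact this

/-- Both sides are liftings of the same loop, and they agree at 0. -/
theorem IsStandardLifting.apply_add_intCast (hφ : IsPiecewiseGeodesicLoop u φ) {f : ℝ → ℍ}
    (hf : IsStandardLifting φ f) (c : ℤ) (t : ℝ) :
    f (t + c) = prefixDeck u (m * c) • f t := by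
  have hm : (m : ℝ) ≠ 0 := by exact_mod_cast NeZero.ne m
  have h1 : IsLifting φ fun t => f (t + c) :=
    ⟨hf.1.1.comp (by fun_prop), fun t => by rw [hf.1.2, circleCover_add_intCast]⟩
  have h2 := (hf.1.smul (prefixDeck_mem u (m * c))).eq_of_eq hφ h1 (t₀ := 0) (by
    rw [hf.2, ← hf.apply_div hφ, zero_add]; push_cast; rw [mul_div_cancel_left₀ _ hm])
  exact congrFun h2 t

/-! ### The common value class of a lattice pair -/

theorem torusPoint_mem_classOf (hφ : IsPiecewiseGeodesicLoop u φ)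
    (hψ : IsPiecewiseGeodesicLoop v ψ) {f h : ℝ → ℍ} (hf : IsStandardLifting φ f)
    (hh : IsStandardLifting ψ h) (k l : ℤ) :
    torusPoint m n k l ∈ classOf (fun t => (prefixDeck u k)⁻¹ • f t)
      (fun t => (prefixDeck v l)⁻¹ • h t) := by
  refine ⟨(k / m, l / n), ?_, rfl⟩
  change (prefixDeck u k)⁻¹ • f (k / m) = (prefixDeck v l)⁻¹ • h (l / n)
  rw [hf.apply_div hφ, hh.apply_div hψ, inv_smul_smul, inv_smul_smul]

theorem onEdge_I : OnEdge g I := by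
  have h : 0 < 2 * g := by have := two_le_genus g; omega
  exact ⟨(⟨0, h⟩, true), 0, by simp, by rw [edge_zero]⟩

/-- Membership gives elements `A`, `B` of the group with `A i = B i`, so they act alike because
vertices have trivial stabilizers. After integer shifts `a`, `b` of the parameters, the given pair
is the normalized pair moved by this common transformation; neither change affects the class. -/
theorem classOf_eq_of_mem (hφ : IsPiecewiseGeodesicLoop u φ)
    (hψ : IsPiecewiseGeodesicLoop v ψ) {f h : ℝ → ℍ} (hf : IsStandardLifting φ f)
    (hh : IsStandardLifting ψ h) (k l : ℤ) {γ σ : SL(2, ℝ)} (hγ : γ ∈ surfaceGroup g)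
    (hσ : σ ∈ surfaceGroup g)
    (hmem : torusPoint m n k l ∈ classOf (fun t => γ • f t) (fun t => σ • h t)) :
    classOf (fun t => γ • f t) (fun t => σ • h t) =
      classOf (fun t => (prefixDeck u k)⁻¹ • f t) (fun t => (prefixDeck v l)⁻¹ • h t) := by
  have hm : (m : ℝ) ≠ 0 := by exact_mod_cast NeZero.ne m
  have hn : (n : ℝ) ≠ 0 := by exact_mod_cast NeZero.ne n
  obtain ⟨⟨s, t⟩, hst : γ • f s = σ • h t, heq⟩ := hmem
  obtain ⟨a, ha⟩ := circleCover_eq_iff.1 (congrArg Prod.fst heq)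
  obtain ⟨b, hb⟩ := circleCover_eq_iff.1 (congrArg Prod.snd heq)
  rw [ha, hb, hf.apply_add_intCast hφ, hh.apply_add_intCast hψ, hf.apply_div hφ,
    hh.apply_div hψ] at hst
  set A := γ * prefixDeck u (m * a) * prefixDeck u k with hA
  set B := σ * prefixDeck v (n * b) * prefixDeck v l with hB
  have hAm : A ∈ surfaceGroup g := mul_mem (mul_mem hγ (prefixDeck_mem _ _)) (prefixDeck_mem _ _)
  have hBm : B ∈ surfaceGroup g := mul_mem (mul_mem hσ (prefixDeck_mem _ _)) (prefixDeck_mem _ _)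
  have hAB : ∀ z : ℍ, A • z = B • z := by
    intro z
    have h1 : (B⁻¹ * A) • I = I := by
      rw [mul_smul, inv_smul_eq_iff, hA, hB, mul_smul, mul_smul, mul_smul, mul_smul]; exact hst
    have h2 := onEdge_I.smul_eq (mul_mem (inv_mem hBm) hAm) h1 z
    rwa [mul_smul, inv_smul_eq_iff] at h2
  have hfs : ∀ x : ℝ, γ • f (x + a) = A • (prefixDeck u k)⁻¹ • f x := by
    intro x
    rw [hf.apply_add_intCast hφ, hA, mul_smul, smul_inv_smul, mul_smul]
  have hhs : ∀ x : ℝ, σ • h (x + b) = B • (prefixDeck v l)⁻¹ • h x := by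
    intro x
    rw [hh.apply_add_intCast hψ, hB, mul_smul, smul_inv_smul, mul_smul]
  have key : ∀ x y : ℝ, γ • f (x + a) = σ • h (y + b) ↔
      (prefixDeck u k)⁻¹ • f x = (prefixDeck v l)⁻¹ • h y := by
    intro x y
    rw [hfs, hhs, ← hAB, smul_left_cancel_iff]
  ext p
  constructor
  · rintro ⟨⟨x, y⟩, hxy : γ • f x = σ • h y, rfl⟩
    refine ⟨(x - a, y - b), ?_, ?_⟩
    · exact (key _ _).1 (by rw [sub_add_cancel, sub_add_cancel, hxy])
    · simp only [Prod.map_apply]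
      rw [← circleCover_add_intCast (x - a) a, ← circleCover_add_intCast (y - b) b, sub_add_cancel,
        sub_add_cancel]
  · rintro ⟨⟨x, y⟩, hxy, rfl⟩
    refine ⟨(x + a, y + b), (key x y).2 hxy, ?_⟩
    simp only [Prod.map_apply, circleCover_add_intCast]

/-- The common value class of a lattice pair is unique. -/
theorem isCommonValueClass_and_mem_iff (hφ : IsPiecewiseGeodesicLoop u φ)
    (hψ : IsPiecewiseGeodesicLoop v ψ) {f h : ℝ → ℍ} (hf : IsStandardLifting φ f)
    (hh : IsStandardLifting ψ h) (k l : ℤ) (C : Set (Circle × Circle)) :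
    (IsCommonValueClass φ ψ C ∧ torusPoint m n k l ∈ C) ↔
      C = classOf (fun t => (prefixDeck u k)⁻¹ • f t) (fun t => (prefixDeck v l)⁻¹ • h t) := by
  constructor
  · rintro ⟨⟨-, f', h', hf', hh', rfl⟩, hmem⟩
    obtain ⟨γ, hγ, rfl⟩ := hf.1.exists_smul hφ hf'
    obtain ⟨σ, hσ, rfl⟩ := hh.1.exists_smul hψ hh'
    exact classOf_eq_of_mem hφ hψ hf hh k l hγ hσ hmem
  · rintro rfl
    have hmem := torusPoint_mem_classOf hφ hψ hf hh k l
    exact ⟨⟨⟨_, hmem⟩, _, _, hf.1.smul (inv_mem (prefixDeck_mem u k)),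
      hh.1.smul (inv_mem (prefixDeck_mem v l)), rfl⟩, hmem⟩

end Lifting

/-! ### Subsets of the torus given by a pair of words -/

section Torus

theorem torusPoint_eq_iff {m n : ℕ} [NeZero m] [NeZero n] {s t s' t' : ℝ} :
    torusPoint m n s t = torusPoint m n s' t' ↔ ∃ a b : ℤ, s = s' + m * a ∧ t = t' + n * b := by
  have hm : (m : ℝ) ≠ 0 := by exact_mod_cast NeZero.ne m
  have hn : (n : ℝ) ≠ 0 := by exact_mod_cast NeZero.ne n
  have h : ∀ (d : ℝ), d ≠ 0 → ∀ (x y : ℝ) (a : ℤ), x / d = y / d + a ↔ x = y + d * a := by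
    intro d hd x y a
    field_simp
  rw [torusPoint, torusPoint, Prod.mk.injEq, circleCover_eq_iff, circleCover_eq_iff]
  simp only [h _ hm, h _ hn]
  exact ⟨fun ⟨⟨a, ha⟩, b, hb⟩ => ⟨a, b, ha, hb⟩, fun ⟨a, b, ha, hb⟩ => ⟨⟨a, ha⟩, b, hb⟩⟩

theorem continuous_torusPoint (m n : ℕ) : Continuous fun p : ℝ × ℝ => torusPoint m n p.1 p.2 := by
  unfold torusPoint
  exact (continuous_circleCover.comp (by fun_prop)).prodMk (continuous_circleCover.comp (by fun_prop))

theorem isOpenMap_torusPoint (m n : ℕ) [NeZero m] [NeZero n] :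
    IsOpenMap fun p : ℝ × ℝ => torusPoint m n p.1 p.2 := by
  have h : ∀ d : ℕ, d ≠ 0 → IsOpenMap fun x : ℝ => circleCover (x / d) := by
    intro d hd
    have h1 : (2 * Real.pi / d : ℝ) ≠ 0 := by
      have := Real.pi_pos.ne'
      have : (d : ℝ) ≠ 0 := by exact_mod_cast hd
      positivity
    have h2 := isLocalHomeomorph_circleExp.isOpenMap.comp (Homeomorph.mulLeft₀ _ h1).isOpenMap
    have h3 : (fun x : ℝ => circleCover (x / d)) =
        Circle.exp ∘ (Homeomorph.mulLeft₀ (2 * Real.pi / d) h1) := by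
      funext x
      simp only [circleCover, Function.comp_apply, Homeomorph.coe_mulLeft₀]
      congr 1; ring
    rw [h3]; exact h2
  exact (h m (NeZero.ne m)).prodMap (h n (NeZero.ne n))

theorem exists_torusPoint {m n : ℕ} [NeZero m] [NeZero n] (x : Circle × Circle) :
    ∃ s t : ℝ, x = torusPoint m n s t := by
  have hm : (m : ℝ) ≠ 0 := by exact_mod_cast NeZero.ne m
  have hn : (n : ℝ) ≠ 0 := by exact_mod_cast NeZero.ne n
  have h : ∀ z : Circle, ∃ s : ℝ, z = circleCover s := by
    intro z
    refine ⟨Complex.arg z / (2 * Real.pi), ?_⟩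
    rw [circleCover, mul_div_cancel₀ _ (by positivity), Circle.exp_arg]
  obtain ⟨s, hs⟩ := h x.1
  obtain ⟨t, ht⟩ := h x.2
  refine ⟨m * s, n * t, ?_⟩
  rw [torusPoint, mul_div_cancel_left₀ _ hm, mul_div_cancel_left₀ _ hn, ← hs, ← ht]

variable {g : ℕ}

/-- The set `E` of pairs of points on two closed paths in a wedge of circles at which the paths
agree, the paths being given by the periodic reduced words `U` and `V`. -/
structure IsCoincidenceSet (m n : ℕ) (U V : ℤ → Letter g) (E : Set (Circle × Circle)) : Prop where
  periodic_left : ∀ k c, U (k + m * c) = U k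
  periodic_right : ∀ k c, V (k + n * c) = V k
  reduced_left : ∀ k, U (k + 1) ≠ (U k).inverse
  reduced_right : ∀ k, V (k + 1) ≠ (V k).inverse
  mem_iff : ∀ (k l : ℤ) {s t : ℝ}, s ∈ Icc (0 : ℝ) 1 → t ∈ Icc (0 : ℝ) 1 →
    (torusPoint m n (k + s) (l + t) ∈ E ↔
      ((s = 0 ∨ s = 1) ∧ (t = 0 ∨ t = 1)) ∨ (U (k + 1) = V (l + 1) ∧ s = t) ∨
        (U (k + 1) = (V (l + 1)).inverse ∧ s = 1 - t))

theorem connectedComponentIn_eq_of_relatively_open {X : Type*} [TopologicalSpace X] {E S : Set X}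
    (hSE : S ⊆ E) (hS : IsPreconnected S) (hcl : IsClosed S) {x : X} (hx : x ∈ S)
    (hop : ∀ p ∈ S, ∃ O, IsOpen O ∧ p ∈ O ∧ O ∩ E ⊆ S) : connectedComponentIn E x = S := by
  apply Subset.antisymm _ (hS.subset_connectedComponentIn hx hSE)
  choose! O hO hpO hOS using hop
  set T := ⋃ p ∈ S, O p with hT
  have hTo : IsOpen T := isOpen_biUnion hO
  have hST : S ⊆ T := fun p hp => mem_biUnion hp (hpO p hp)
  have hTS : T ∩ E ⊆ S := by
    rintro p ⟨hp, hpE⟩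
    obtain ⟨q, hq, hpq⟩ := mem_iUnion₂.1 hp
    exact hOS q hq ⟨hpq, hpE⟩
  have hCE := connectedComponentIn_subset E x
  have hxC : x ∈ connectedComponentIn E x := mem_connectedComponentIn (hSE hx)
  by_contra hcon
  obtain ⟨y, hy, hyS⟩ := not_subset.1 hcon
  obtain ⟨z, hz, hzT, hzS⟩ := isPreconnected_connectedComponentIn T Sᶜ hTo hcl.isOpen_compl
    (fun p _ => (em (p ∈ S)).imp (fun h => hST h) id) ⟨x, hxC, hST hx⟩ ⟨y, hy, hyS⟩
  exact hzS (hTS ⟨hzT, hCE hz⟩)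

theorem Letter.ne_inverse_self (a : Letter g) : a ≠ a.inverse := by
  intro h
  have := congrArg Prod.snd h
  simp [Letter.inverse] at this

theorem Letter.inverse_involutive (a : Letter g) : a.inverse.inverse = a := by
  simp [Letter.inverse]

/-- The diagonal line through a lattice point, restricted to a set of parameters. -/
def diagonal (m n : ℕ) (k l : ℤ) (J : Set ℝ) : Set (Circle × Circle) :=
  (fun r : ℝ => torusPoint m n (k + r) (l + r)) '' J

theorem continuous_diagonal (m n : ℕ) (k l : ℤ) :
    Continuous fun r : ℝ => torusPoint m n (k + r) (l + r) :=
  (continuous_torusPoint m n).comp (by fun_prop : Continuous fun r : ℝ => ((k : ℝ) + r, (l : ℝ) + r))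

variable {m n : ℕ} [NeZero m] [NeZero n] {U V : ℤ → Letter g} {E : Set (Circle × Circle)}

/-- The four quadrants at a lattice point lie in four unit squares: the first and third can
contribute a piece of the diagonal, the other two a piece of an antidiagonal. -/
theorem IsCoincidenceSet.near_lattice (hE : IsCoincidenceSet m n U V E) (k l : ℤ) {x y : ℝ}
    (hx : |x| < 1 / 2) (hy : |y| < 1 / 2) (h : torusPoint m n (k + x) (l + y) ∈ E) :
    (x = 0 ∧ y = 0) ∨ (x = y ∧ 0 < x ∧ U (k + 1) = V (l + 1)) ∨ (x = y ∧ x < 0 ∧ U k = V l) ∨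
      (U (k + 1) = (V l).inverse) ∨ (U k = (V (l + 1)).inverse) := by
  rw [abs_lt] at hx hy
  rcases le_or_gt 0 x with hx0 | hx0 <;> rcases le_or_gt 0 y with hy0 | hy0
  · rcases (hE.mem_iff k l ⟨hx0, by linarith⟩ ⟨hy0, by linarith⟩).1 h with
      ⟨h1 | h1, h2 | h2⟩ | ⟨h1, h2⟩ | ⟨h1, h2⟩
    · exact Or.inl ⟨h1, h2⟩
    · linarith
    · linarith
    · linarith
    · rcases hx0.eq_or_lt with h0 | h0
      · exact Or.inl ⟨h0.symm, by rw [← h2, h0]⟩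
      · exact Or.inr (Or.inl ⟨h2, h0, h1⟩)
    · linarith
  · have e : torusPoint m n (k + x) (l + y) =
        torusPoint m n (k + x) (((l - 1 : ℤ) : ℝ) + (y + 1)) := by push_cast; congr 1; ring
    rw [e] at h
    rcases (hE.mem_iff k (l - 1) ⟨hx0, by linarith⟩ ⟨by linarith, by linarith⟩).1 h with
      ⟨h1 | h1, h2 | h2⟩ | ⟨h1, h2⟩ | ⟨h1, h2⟩
    · linarith
    · linarith
    · linarith
    · linarith
    · linarith
    · rw [sub_add_cancel] at h1
      exact Or.inr (Or.inr (Or.inr (Or.inl h1)))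
  · have e : torusPoint m n (k + x) (l + y) =
        torusPoint m n (((k - 1 : ℤ) : ℝ) + (x + 1)) (l + y) := by push_cast; congr 1; ring
    rw [e] at h
    rcases (hE.mem_iff (k - 1) l ⟨by linarith, by linarith⟩ ⟨hy0, by linarith⟩).1 h with
      ⟨h1 | h1, h2 | h2⟩ | ⟨h1, h2⟩ | ⟨h1, h2⟩
    · linarith
    · linarith
    · linarith
    · linarith
    · linarith
    · rw [sub_add_cancel] at h1
      exact Or.inr (Or.inr (Or.inr (Or.inr h1)))
  · have e : torusPoint m n (k + x) (l + y) =
        torusPoint m n (((k - 1 : ℤ) : ℝ) + (x + 1)) (((l - 1 : ℤ) : ℝ) + (y + 1)) := by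
      push_cast; congr 1 <;> ring
    rw [e] at h
    rcases (hE.mem_iff (k - 1) (l - 1) ⟨by linarith, by linarith⟩
      ⟨by linarith, by linarith⟩).1 h with ⟨h1 | h1, h2 | h2⟩ | ⟨h1, h2⟩ | ⟨h1, h2⟩
    · linarith
    · linarith
    · linarith
    · linarith
    · rw [sub_add_cancel, sub_add_cancel] at h1
      exact Or.inr (Or.inr (Or.inl ⟨by linarith, hx0, h1⟩))
    · linarith

theorem isOpen_torusBox (s t ε : ℝ) :
    IsOpen ((fun p : ℝ × ℝ => torusPoint m n p.1 p.2) '' (Metric.ball s ε ×ˢ Metric.ball t ε)) :=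
  isOpenMap_torusPoint m n _ (Metric.isOpen_ball.prod Metric.isOpen_ball)

/-- A piece of a diagonal is a component if it is maximal. -/
theorem IsCoincidenceSet.connectedComponentIn_diagonal (hE : IsCoincidenceSet m n U V E) {k l : ℤ}
    {J : Set ℝ} (hJ : IsPreconnected J) (hcl : IsClosed (diagonal m n k l J))
    (hA : ∀ (i : ℤ), ∀ r ∈ J, (i : ℝ) < r → r < i + 1 → U (k + i + 1) = V (l + i + 1))
    (hB : ∀ i : ℤ, (i : ℝ) ∈ J → U (k + i) = V (l + i) ∨ U (k + i + 1) = V (l + i + 1))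
    (hC : ∀ (i : ℤ), ∀ r ∈ J, (i : ℝ) ≤ r → r ≤ i + 1 → U (k + i + 1) = V (l + i + 1) →
      Icc (i : ℝ) (i + 1) ⊆ J) {r₀ : ℝ} (hr₀ : r₀ ∈ J) :
    connectedComponentIn E (torusPoint m n (k + r₀) (l + r₀)) = diagonal m n k l J := by
  have hcast : ∀ (i : ℤ) (x y : ℝ), torusPoint m n (k + (i + x)) (l + (i + y)) =
      torusPoint m n (((k + i : ℤ) : ℝ) + x) (((l + i : ℤ) : ℝ) + y) := by
    intro i x y; push_cast; congr 1 <;> ring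
  have hfr : ∀ r : ℝ, r = ⌊r⌋ ∨ ((⌊r⌋ : ℝ) < r ∧ r < ⌊r⌋ + 1) := fun r =>
    (Int.floor_le r).eq_or_lt.imp (fun h => h.symm) fun h => ⟨h, Int.lt_floor_add_one r⟩
  -- By `hA` the piece lies in `E`. For openness in `E`, `hB` with reducedness excludes
  -- antidiagonals through its lattice points, and `hC` excludes a continuation beyond its ends.
  refine connectedComponentIn_eq_of_relatively_open ?_
    (hJ.image _ (continuous_diagonal m n k l).continuousOn) hcl (mem_image_of_mem _ hr₀) ?_
  · rintro _ ⟨r, hr, rfl⟩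
    rcases hfr r with h | ⟨h1, h2⟩
    · have := (hE.mem_iff (k + ⌊r⌋) (l + ⌊r⌋) (s := 0) (t := 0) (by simp) (by simp)).2 (by simp)
      rw [← hcast, add_zero, ← h] at this
      exact this
    · have hs : r - ⌊r⌋ ∈ Icc (0 : ℝ) 1 := ⟨by linarith, by linarith⟩
      have := (hE.mem_iff (k + ⌊r⌋) (l + ⌊r⌋) hs hs).2 (Or.inr (Or.inl ⟨hA _ r hr h1 h2, rfl⟩))
      rw [← hcast, add_sub_cancel] at this
      exact this
  · rintro _ ⟨r, hr, rfl⟩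
    suffices ∃ ε > 0, ∀ x y : ℝ, |x| < ε → |y| < ε →
        torusPoint m n (k + (r + x)) (l + (r + y)) ∈ E → x = y ∧ r + x ∈ J by
      obtain ⟨ε, hε, h⟩ := this
      refine ⟨_, isOpen_torusBox (k + r) (l + r) ε,
        ⟨(k + r, l + r), ⟨Metric.mem_ball_self hε, Metric.mem_ball_self hε⟩, rfl⟩, ?_⟩
      rintro _ ⟨⟨⟨s, t⟩, ⟨hs, ht⟩, rfl⟩, hmem⟩
      rw [Metric.mem_ball, Real.dist_eq] at hs ht
      simp only at hs ht hmem
      have e1 : s = k + (r + (s - (k + r))) := by ring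
      have e2 : t = l + (r + (t - (l + r))) := by ring
      obtain ⟨h1, h2⟩ := h (s - (k + r)) (t - (l + r)) hs ht (by rwa [← e1, ← e2])
      refine ⟨_, h2, ?_⟩
      change torusPoint m n _ _ = torusPoint m n s t
      congr 1
      · ring
      · rw [h1]; ring
    rcases hfr r with h | ⟨h1, h2⟩
    · refine ⟨1 / 2, by norm_num, fun x y hx hy hmem => ?_⟩
      set i := ⌊r⌋
      rw [h] at hmem hr ⊢
      rw [hcast] at hmem
      have hiJ := hB i hr
      rcases hE.near_lattice (k + i) (l + i) hx hy hmem with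
        ⟨h1, h2⟩ | ⟨h1, h2, h3⟩ | ⟨h1, h2, h3⟩ | h3 | h3
      · exact ⟨by rw [h1, h2], by rwa [h1, add_zero]⟩
      · refine ⟨h1, hC i i hr le_rfl (by linarith) h3 ⟨by linarith, ?_⟩⟩
        linarith [(abs_lt.1 hx).2]
      · refine ⟨h1, ?_⟩
        have h4 := hC (i - 1) i hr (by push_cast; linarith) (by push_cast; linarith)
          (by simpa only [add_sub_assoc', sub_add_cancel] using h3)
        apply h4
        push_cast
        exact ⟨by linarith [(abs_lt.1 hx).1], by linarith⟩
      -- An antidiagonal branch next to a diagonal one would make two consecutive letters of `U` or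
      -- of `V` inverse to each other.
      · exfalso
        rcases hiJ with h4 | h4
        · exact hE.reduced_left (k + i) (by rw [h3, h4])
        · refine hE.reduced_right (l + i) (by rw [← h4, h3])
      · exfalso
        rcases hiJ with h4 | h4
        · refine hE.reduced_right (l + i) ?_
          rw [← h4, h3, Letter.inverse_involutive]
        · refine hE.reduced_left (k + i) ?_
          rw [h4, h3, Letter.inverse_involutive]
    · have hd := hA _ r hr h1 h2
      have hsub := hC _ r hr h1.le h2.le hd
      set i := ⌊r⌋
      -- This radius keeps the neighbourhood inside one open unit square, where the antidiagonal is
      -- absent because no letter is its own inverse.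
      refine ⟨min (r - i) (i + 1 - r), lt_min (by linarith) (by linarith),
        fun x y hx hy hmem => ?_⟩
      rw [lt_min_iff, abs_lt, abs_lt] at hx hy
      have e : torusPoint m n (k + (r + x)) (l + (r + y)) =
          torusPoint m n (((k + i : ℤ) : ℝ) + (r - i + x)) (((l + i : ℤ) : ℝ) + (r - i + y)) := by
        push_cast; congr 1 <;> ring
      rw [e] at hmem
      refine ⟨?_, hsub ⟨by linarith, by linarith⟩⟩
      rcases (hE.mem_iff (k + i) (l + i) ⟨by linarith, by linarith⟩
        ⟨by linarith, by linarith⟩).1 hmem with ⟨h3 | h3, -⟩ | ⟨-, h3⟩ | ⟨h3, -⟩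
      · linarith
      · linarith
      · linarith
      · exact absurd (hd.symm.trans h3) (Letter.ne_inverse_self _)

theorem parallelSegment_eq_diagonal (k l : ℤ) (q : ℕ) :
    parallelSegment m n k l q = diagonal m n k l (Icc 0 q) := rfl

theorem parallelLine_eq_diagonal (k l : ℤ) :
    parallelLine m n k l = diagonal m n k l univ := by
  rw [diagonal, image_univ]; rfl

/-- If a common period has length at most `q`, then a segment of length `q` is a closed curve. -/
theorem parallelSegment_eq_parallelLine {k l a b : ℤ} {q : ℕ} (h0 : 0 < (m : ℤ) * a)
    (hq : (m : ℤ) * a ≤ q) (hab : (m : ℤ) * a = n * b) :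
    parallelSegment m n k l q = parallelLine m n k l := by
  apply Subset.antisymm
  · rintro _ ⟨r, -, rfl⟩
    exact ⟨r, rfl⟩
  · rintro _ ⟨r, rfl⟩
    have h0' : (0 : ℝ) < m * a := by exact_mod_cast h0
    have hq' : (m * a : ℝ) ≤ q := by exact_mod_cast hq
    have hab' : (m * a : ℝ) = n * b := by exact_mod_cast hab
    -- The parameter is reduced modulo the common period `m a = n b`.
    set c := ⌊r / (m * a)⌋ with hc
    have h1 : (c : ℝ) * (m * a) ≤ r := (le_div_iff₀ h0').1 (Int.floor_le _)
    have h2 : r < (c + 1) * (m * a) := (div_lt_iff₀ h0').1 (Int.lt_floor_add_one _)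
    refine ⟨r - c * (m * a), ⟨by linarith, by linarith⟩, ?_⟩
    refine torusPoint_eq_iff.2 ⟨-(c * a), -(c * b), ?_, ?_⟩
    · push_cast; ring
    · rw [hab']; push_cast; ring

/-- The line closes up after the common period mn, so it is a compact segment. -/
theorem isClosed_parallelLine (k l : ℤ) : IsClosed (parallelLine m n k l) := by
  have hm : (0 : ℤ) < m := by exact_mod_cast NeZero.pos m
  have hn : (0 : ℤ) < n := by exact_mod_cast NeZero.pos n
  rw [← parallelSegment_eq_parallelLine (a := n) (b := m) (q := m * n) (by positivity)
    (by push_cast; exact le_rfl) (mul_comm _ _)]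
  exact (isCompact_Icc.image (continuous_diagonal m n k l)).isClosed

/-- The component of a point on a diagonal of `E`. -/
theorem IsCoincidenceSet.parallel_component (hE : IsCoincidenceSet m n U V E) {k l : ℤ}
    (h : U (k + 1) = V (l + 1)) {s : ℝ} (hs : s ∈ Icc (0 : ℝ) 1) : ∃ k' l' : ℤ,
    (∃ q : ℕ, 0 < q ∧ connectedComponentIn E (torusPoint m n (k + s) (l + s)) =
      parallelSegment m n k' l' q) ∨
    connectedComponentIn E (torusPoint m n (k + s) (l + s)) = parallelLine m n k' l' := by
  by_cases hall : ∀ i : ℤ, U (k + i) = V (l + i)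
  · refine ⟨k, l, Or.inr ?_⟩
    rw [parallelLine_eq_diagonal]
    refine hE.connectedComponentIn_diagonal isPreconnected_univ ?_ ?_ ?_ ?_ (mem_univ s)
    · rw [← parallelLine_eq_diagonal]; exact isClosed_parallelLine k l
    · intro i _ _ _ _
      rw [add_assoc, add_assoc]; exact hall _
    · intro i _
      exact Or.inl (hall i)
    · intros; exact subset_univ _
  · push Not at hall
    obtain ⟨i, hi⟩ := hall
    have hm : (0 : ℤ) < m := by exact_mod_cast NeZero.pos m
    have hn : (0 : ℤ) < n := by exact_mod_cast NeZero.pos n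
    have hmn : (1 : ℤ) ≤ m * n := by nlinarith
    have hper : ∀ c : ℤ, U (k + (i + m * n * c)) ≠ V (l + (i + m * n * c)) := by
      intro c
      have e1 : k + (i + m * n * c) = k + i + m * (n * c) := by ring
      have e2 : l + (i + m * n * c) = l + i + n * (m * c) := by ring
      rw [e1, e2, hE.periodic_left, hE.periodic_right]
      exact hi
    -- Mismatches repeat with period mn, so they occur on both sides of the matched letter with
    -- index 1. The nearest ones, `p ≤ 0` and `p' ≥ 2`, delimit the maximal run p+1, …, p'-1.
    obtain ⟨p, ⟨hp1, hp2⟩, hpmax⟩ := Int.exists_greatest_of_bdd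
      (P := fun j => j ≤ 0 ∧ U (k + j) ≠ V (l + j)) ⟨0, fun j hj => hj.1⟩
      ⟨i + m * n * (-|i|), by nlinarith [le_abs_self i, abs_nonneg i], hper _⟩
    obtain ⟨p', ⟨hp1', hp2'⟩, hpmin⟩ := Int.exists_least_of_bdd
      (P := fun j => 2 ≤ j ∧ U (k + j) ≠ V (l + j)) ⟨2, fun j hj => hj.1⟩
      ⟨i + m * n * (|i| + 2), by nlinarith [neg_abs_le i, abs_nonneg i], hper _⟩
    have hD : ∀ j : ℤ, p < j → j < p' → U (k + j) = V (l + j) := by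
      intro j h1 h2
      by_contra hne
      rcases le_or_gt j 0 with h3 | h3
      · exact absurd (hpmax j ⟨h3, hne⟩) (by omega)
      · rcases le_or_gt 2 j with h4 | h4
        · exact absurd (hpmin j ⟨h4, hne⟩) (by omega)
        · have : j = 1 := by omega
          rw [this] at hne
          exact hne h
    obtain ⟨q, hq⟩ : ∃ q : ℕ, (q : ℤ) = p' - 1 - p := ⟨(p' - 1 - p).toNat, by omega⟩
    have hqR : (q : ℝ) = p' - 1 - p := by exact_mod_cast hq
    refine ⟨k + p, l + p, Or.inl ⟨q, by omega, ?_⟩⟩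
    have hp0 : (p : ℝ) ≤ 0 := by exact_mod_cast hp1
    have hp0' : (2 : ℝ) ≤ p' := by exact_mod_cast hp1'
    have key := hE.connectedComponentIn_diagonal (k := k + p) (l := l + p) (J := Icc 0 (q : ℝ))
      (r₀ := s - p) isPreconnected_Icc
      (isCompact_Icc.image (continuous_diagonal m n _ _)).isClosed ?_ ?_ ?_
      ⟨by linarith [hs.1], by linarith [hs.2]⟩
    · rw [parallelSegment_eq_diagonal, ← key]
      congr 2 <;> push_cast <;> ring
    · intro i r hr h1 h2
      have h3 : (-1 : ℤ) < i := by exact_mod_cast (by push_cast; linarith [hr.1] : ((-1 : ℤ) : ℝ) < i)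
      have h4 : i < (q : ℤ) := by exact_mod_cast (by push_cast; linarith [hr.2] : (i : ℝ) < (q : ℤ))
      have := hD (p + i + 1) (by omega) (by omega)
      simpa only [add_assoc] using this
    · intro i hi
      have h3 : (0 : ℤ) ≤ i := by exact_mod_cast hi.1
      have h4 : i ≤ (q : ℤ) := by exact_mod_cast hi.2
      rcases eq_or_ne i q with h5 | h5
      · left
        have := hD (p + i) (by omega) (by omega)
        simpa only [add_assoc] using this
      · right
        have := hD (p + i + 1) (by omega) (by omega)
        simpa only [add_assoc] using this
    · intro i r hr h1 h2 h3 x hx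
      have h4 : (-1 : ℤ) ≤ i := by
        exact_mod_cast (by push_cast; linarith [hr.1] : ((-1 : ℤ) : ℝ) ≤ i)
      have h5 : i ≤ (q : ℤ) := by exact_mod_cast (by push_cast; linarith [hr.2] : (i : ℝ) ≤ (q : ℤ))
      -- A matched unit interval touching the segment from outside would be the one ending at its
      -- start or the one beginning at its end, but these carry the mismatches `p` and `p'`.
      have h6 : i ≠ -1 := by
        rintro rfl
        apply hp2
        simpa using h3
      have h7 : i ≠ q := by
        rintro rfl
        apply hp2'
        have e : p' = p + q + 1 := by omega
        rw [e]
        simpa only [add_assoc] using h3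
      have h8 : (0 : ℝ) ≤ i := by exact_mod_cast (by omega : (0 : ℤ) ≤ i)
      have h9 : (i : ℝ) + 1 ≤ q := by exact_mod_cast (by omega : i + 1 ≤ (q : ℤ))
      exact ⟨by linarith [hx.1], by linarith [hx.2]⟩

theorem IsCoincidenceSet.isolated_component (hE : IsCoincidenceSet m n U V E) {k l : ℤ}
    (h1 : U (k + 1) ≠ V (l + 1)) (h2 : U k ≠ V l) (h3 : U (k + 1) ≠ (V l).inverse)
    (h4 : U k ≠ (V (l + 1)).inverse) :
    connectedComponentIn E (torusPoint m n k l) = {torusPoint m n k l} := by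
  have hmem : torusPoint m n k l ∈ E := by
    have := (hE.mem_iff k l (s := 0) (t := 0) (by simp) (by simp)).2 (by simp)
    rwa [add_zero, add_zero] at this
  refine connectedComponentIn_eq_of_relatively_open (singleton_subset_iff.2 hmem)
    isPreconnected_singleton isClosed_singleton (mem_singleton _) ?_
  rintro _ rfl
  refine ⟨_, isOpen_torusBox k l (1 / 2), ⟨(k, l), ⟨Metric.mem_ball_self (by norm_num),
    Metric.mem_ball_self (by norm_num)⟩, rfl⟩, ?_⟩
  rintro _ ⟨⟨⟨s, t⟩, ⟨hs, ht⟩, rfl⟩, hst⟩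
  rw [Metric.mem_ball, Real.dist_eq] at hs ht
  simp only at hs ht hst
  have e1 : s = k + (s - k) := by ring
  have e2 : t = l + (t - l) := by ring
  rw [e1, e2] at hst
  rcases hE.near_lattice k l hs ht hst with ⟨h5, h6⟩ | ⟨-, -, h⟩ | ⟨-, -, h⟩ | h | h
  · have e3 : s = k := by linarith
    have e4 : t = l := by linarith
    simp only [e3, e4]
    rfl
  · exact absurd h h1
  · exact absurd h h2
  · exact absurd h h3
  · exact absurd h h4

/-- The diagonal of a square with matching letters is a connected subset of `E`, so it lies in a
single component. -/
theorem IsCoincidenceSet.arm_mem (hE : IsCoincidenceSet m n U V E) {k l : ℤ}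
    (h : U (k + 1) = V (l + 1)) {x : Circle × Circle} {s₀ s : ℝ} (hs₀ : s₀ ∈ Icc (0 : ℝ) 1)
    (hs : s ∈ Icc (0 : ℝ) 1) (hx : torusPoint m n (k + s₀) (l + s₀) ∈ connectedComponentIn E x) :
    torusPoint m n (k + s) (l + s) ∈ connectedComponentIn E x := by
  have hsub : diagonal m n k l (Icc 0 1) ⊆ E := by
    rintro _ ⟨r, hr, rfl⟩
    exact (hE.mem_iff k l hr hr).2 (Or.inr (Or.inl ⟨h, rfl⟩))
  have hpre : IsPreconnected (diagonal m n k l (Icc 0 1)) :=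
    isPreconnected_Icc.image _ (continuous_diagonal m n k l).continuousOn
  rw [connectedComponentIn_eq hx]
  exact hpre.subset_connectedComponentIn (mem_image_of_mem _ hs₀) hsub (mem_image_of_mem _ hs)

/-- A match on either side would bring the midpoint of a diagonal into the component, and a
half-integer shift is not a multiple of `m`. -/
theorem IsCoincidenceSet.letters_of_singleton (hE : IsCoincidenceSet m n U V E) {k l : ℤ}
    {x : Circle × Circle} (hx : connectedComponentIn E x = {torusPoint m n k l}) :
    U k ≠ V l ∧ U (k + 1) ≠ V (l + 1) := by
  have hodd : ∀ (a : ℤ) (e : ℤ), (e = 1 ∨ e = -1) → ((e : ℝ) / 2 ≠ m * a) := by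
    intro a e he h
    have h1 : (e : ℝ) = ((2 * (m * a) : ℤ) : ℝ) := by push_cast; linarith
    have h2 : e = 2 * (m * a) := by exact_mod_cast h1
    omega
  constructor
  · intro h
    have h' : U (k - 1 + 1) = V (l - 1 + 1) := by rwa [sub_add_cancel, sub_add_cancel]
    have := hE.arm_mem h' (x := x) (s₀ := 1) (s := 1 / 2) (by simp) (by norm_num)
      (by rw [hx]; push_cast; rw [sub_add_cancel, sub_add_cancel]; rfl)
    rw [hx, mem_singleton_iff, torusPoint_eq_iff] at this
    obtain ⟨a, b, ha, -⟩ := this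
    push_cast at ha
    exact hodd a (-1) (Or.inr rfl) (by push_cast; linarith)
  · intro h
    have := hE.arm_mem h (x := x) (s₀ := 0) (s := 1 / 2) (by simp) (by norm_num)
      (by rw [hx, add_zero, add_zero]; rfl)
    rw [hx, mem_singleton_iff, torusPoint_eq_iff] at this
    obtain ⟨a, b, ha, -⟩ := this
    exact hodd a 1 (Or.inl rfl) (by push_cast; linarith)

/-- The parameter 1/3 avoids the corners and, unlike 1/2, also the antidiagonal; only equality of
letters remains. -/
theorem IsCoincidenceSet.letter_eq_of_third_mem (hE : IsCoincidenceSet m n U V E) {k l r : ℤ}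
    (h : torusPoint m n (k + (r - 1 + 1 / 3)) (l + (r - 1 + 1 / 3)) ∈ E) :
    U (k + r) = V (l + r) := by
  have e : torusPoint m n (k + (r - 1 + 1 / 3)) (l + (r - 1 + 1 / 3)) =
      torusPoint m n (((k + r - 1 : ℤ) : ℝ) + 1 / 3) (((l + r - 1 : ℤ) : ℝ) + 1 / 3) := by
    push_cast; congr 1 <;> ring
  rw [e] at h
  rcases (hE.mem_iff _ _ (by norm_num) (by norm_num)).1 h with ⟨h1 | h1, -⟩ | ⟨h1, -⟩ | ⟨-, h1⟩
  · norm_num at h1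
  · norm_num at h1
  · rwa [sub_add_cancel, sub_add_cancel] at h1
  · norm_num at h1

theorem IsCoincidenceSet.letters_of_parallelLine (hE : IsCoincidenceSet m n U V E) {k l : ℤ}
    {x : Circle × Circle} (hx : connectedComponentIn E x = parallelLine m n k l) (r : ℤ) :
    U (k + r) = V (l + r) := by
  apply hE.letter_eq_of_third_mem
  apply connectedComponentIn_subset E x
  rw [hx]
  exact ⟨_, rfl⟩

/-- The point lies on the diagonal less than one unit outside the segment. If it is also a point of
the segment, the two parameters differ by a common period of length at most `q`, so the segment
already runs round the closed curve. -/
theorem parallelSegment_eq_parallelLine_of_mem {k l : ℤ} {q : ℕ} {d : ℝ}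
    (hd : (-1 < d ∧ d < 0) ∨ ((q : ℝ) < d ∧ d < q + 1))
    (h : torusPoint m n (k + d) (l + d) ∈ parallelSegment m n k l q) :
    parallelSegment m n k l q = parallelLine m n k l := by
  obtain ⟨r, ⟨hr0, hr1⟩, h⟩ := h
  obtain ⟨a, b, ha, hb⟩ := torusPoint_eq_iff.1 h
  have hab : (m : ℤ) * a = n * b := by
    have : (m : ℝ) * a = n * b := by linarith
    exact_mod_cast this
  rcases hd with ⟨h1, h2⟩ | ⟨h1, h2⟩
  · have e1 : (0 : ℤ) < m * a := by exact_mod_cast (by linarith : (0 : ℝ) < m * a)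
    have e2 : (m : ℤ) * a < q + 1 := by exact_mod_cast (by linarith : (m * a : ℝ) < q + 1)
    exact parallelSegment_eq_parallelLine e1 (by omega) hab
  · have e1 : (m : ℤ) * a < 0 := by exact_mod_cast (by linarith : (m * a : ℝ) < 0)
    have e2 : (-(q + 1) : ℤ) < m * a := by
      exact_mod_cast (by linarith : (-(q + 1) : ℝ) < m * a)
    refine parallelSegment_eq_parallelLine (a := -a) (b := -b) ?_ ?_ ?_
    · rw [mul_neg]; omega
    · rw [mul_neg]; omega
    · rw [mul_neg, mul_neg, hab]

theorem IsCoincidenceSet.letters_of_parallelSegment (hE : IsCoincidenceSet m n U V E) {k l : ℤ}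
    {q : ℕ} {x : Circle × Circle} (hx : connectedComponentIn E x = parallelSegment m n k l q)
    (hne : connectedComponentIn E x ≠ parallelLine m n k l) :
    (∀ r : ℤ, 1 ≤ r → r ≤ q → U (k + r) = V (l + r)) ∧ U k ≠ V l ∧
      U (k + q + 1) ≠ V (l + q + 1) := by
  refine ⟨fun r h1 h2 => ?_, fun h => ?_, fun h => ?_⟩
  · apply hE.letter_eq_of_third_mem
    apply connectedComponentIn_subset E x
    rw [hx]
    have h1' : (1 : ℝ) ≤ r := by exact_mod_cast h1
    have h2' : (r : ℝ) ≤ q := by exact_mod_cast h2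
    exact ⟨r - 1 + 1 / 3, ⟨by linarith, by linarith⟩, rfl⟩
  -- A match just before the start would put the midpoint of the preceding diagonal into the
  -- component, so the segment would be the whole closed curve. The end is treated in the same way.
  · have h' : U (k - 1 + 1) = V (l - 1 + 1) := by rwa [sub_add_cancel, sub_add_cancel]
    have := hE.arm_mem h' (x := x) (s₀ := 1) (s := 1 / 2) (by simp) (by norm_num)
      (by
        rw [hx]
        refine ⟨0, by simp, ?_⟩
        push_cast; simp)
    apply hne
    rw [hx]
    apply parallelSegment_eq_parallelLine_of_mem (d := -1 / 2) (Or.inl (by norm_num))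
    rw [hx] at this
    convert this using 2 <;> push_cast <;> ring
  · have := hE.arm_mem h (x := x) (s₀ := 0) (s := 1 / 2) (by simp) (by norm_num)
      (by
        rw [hx]
        refine ⟨q, by simp, ?_⟩
        push_cast; simp)
    apply hne
    rw [hx]
    apply parallelSegment_eq_parallelLine_of_mem (d := q + 1 / 2)
      (Or.inr ⟨by linarith, by linarith⟩)
    rw [hx] at this
    convert this using 2 <;> push_cast <;> ring

end Torus

/-! ### Reversing the second path -/

section Flip

variable {g m n : ℕ}

/-- The reflection `(x, y) ↦ (x, y⁻¹)` of the torus. -/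
def torusFlip : Circle × Circle ≃ₜ Circle × Circle :=
  (Homeomorph.refl Circle).prodCongr (Homeomorph.inv Circle)

theorem torusFlip_torusPoint (s t : ℝ) :
    torusFlip (torusPoint m n s t) = torusPoint m n s (-t) := by
  have : circleCover (-t / n) = (circleCover (t / n))⁻¹ := by
    rw [circleCover, circleCover, ← Circle.exp_neg]; congr 1; ring
  rw [torusPoint, torusPoint, this]
  rfl

theorem torusFlip_torusFlip (p : Circle × Circle) : torusFlip (torusFlip p) = p := by
  change (p.1, (p.2⁻¹)⁻¹) = p
  rw [inv_inv]

theorem image_torusFlip_eq_iff {S T : Set (Circle × Circle)} :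
    torusFlip '' S = T ↔ S = torusFlip '' T := by
  have h : ∀ S : Set (Circle × Circle), torusFlip '' (torusFlip '' S) = S := by
    intro S
    rw [image_image]; simp [torusFlip_torusFlip]
  exact ⟨fun e => by rw [← e, h], fun e => by rw [e, h]⟩

theorem image_torusFlip_eq_preimage (S : Set (Circle × Circle)) :
    torusFlip '' S = torusFlip ⁻¹' S :=
  congrFun (image_eq_preimage_of_inverse torusFlip_torusFlip torusFlip_torusFlip) S

theorem image_torusFlip_parallelSegment (k l : ℤ) (q : ℕ) :
    torusFlip '' parallelSegment m n k l q = antiparallelSegment m n k (-l - q) q := by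
  rw [parallelSegment, antiparallelSegment, image_image]
  refine image_congr fun r _ => ?_
  rw [torusFlip_torusPoint]; push_cast; congr 1; ring

theorem image_torusFlip_antiparallelSegment (k l : ℤ) (q : ℕ) :
    torusFlip '' antiparallelSegment m n k l q = parallelSegment m n k (-(l + q)) q := by
  rw [parallelSegment, antiparallelSegment, image_image]
  refine image_congr fun r _ => ?_
  rw [torusFlip_torusPoint]; push_cast; congr 1; ring

theorem image_torusFlip_parallelLine (k l : ℤ) :
    torusFlip '' parallelLine m n k l = antiparallelLine m n k (-l) := by
  rw [parallelLine, antiparallelLine, ← range_comp]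
  congr 1
  funext r
  rw [Function.comp_apply, torusFlip_torusPoint]; push_cast; congr 1; ring

theorem image_torusFlip_antiparallelLine (k l : ℤ) :
    torusFlip '' antiparallelLine m n k l = parallelLine m n k (-l) := by
  rw [image_torusFlip_eq_iff, image_torusFlip_parallelLine, neg_neg]

theorem connectedComponentIn_torusFlip {E : Set (Circle × Circle)} {x : Circle × Circle}
    (hx : x ∈ E) : connectedComponentIn (torusFlip '' E) (torusFlip x) =
      torusFlip '' connectedComponentIn E x :=
  (torusFlip.image_connectedComponentIn hx).symm

/-- The inverse word. -/
def reverseWord (V : ℤ → Letter g) (l : ℤ) : Letter g := (V (1 - l)).inverse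

variable [NeZero m] [NeZero n] {U V : ℤ → Letter g} {E : Set (Circle × Circle)}

/-- Reversing the second path exchanges diagonals and antidiagonals. The letter with index l belongs
to the interval [l-1, l], whose mirror image [-l, 1-l] has index 1-l; this explains the shift in
`reverseWord`. -/
theorem IsCoincidenceSet.flip (hE : IsCoincidenceSet m n U V E) :
    IsCoincidenceSet m n U (reverseWord V) (torusFlip '' E) where
  periodic_left := hE.periodic_left
  periodic_right k c := by
    have : 1 - (k + n * c) = 1 - k + n * (-c) := by ring
    rw [reverseWord, reverseWord, this, hE.periodic_right]
  reduced_left := hE.reduced_left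
  reduced_right k := by
    have := hE.reduced_right (-k)
    rw [reverseWord, reverseWord, Letter.inverse_involutive, show 1 - (k + 1) = -k by ring]
    rw [neg_add_eq_sub] at this
    exact this.symm
  mem_iff k l s t hs ht := by
    have e : torusFlip (torusPoint m n (k + s) (l + t)) =
        torusPoint m n (k + s) (((-l - 1 : ℤ) : ℝ) + (1 - t)) := by
      rw [torusFlip_torusPoint]; push_cast; congr 1; ring
    have ht' : 1 - t ∈ Icc (0 : ℝ) 1 := ⟨by linarith [ht.2], by linarith [ht.1]⟩
    have e2 : (reverseWord V (l + 1)) = (V (-l - 1 + 1)).inverse := by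
      rw [reverseWord]; congr 2; ring
    rw [image_torusFlip_eq_preimage, mem_preimage, e, hE.mem_iff k (-l - 1) hs ht', e2,
      Letter.inverse_involutive, sub_sub_cancel, sub_eq_zero, sub_eq_self, eq_comm (a := 1)]
    tauto

theorem IsCoincidenceSet.antiparallel_component (hE : IsCoincidenceSet m n U V E) {k l : ℤ}
    (h : U (k + 1) = (V (l + 1)).inverse) {s : ℝ} (hs : s ∈ Icc (0 : ℝ) 1) : ∃ k' l' : ℤ,
    (∃ q : ℕ, 0 < q ∧ connectedComponentIn E (torusPoint m n (k + s) (l + (1 - s))) =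
      antiparallelSegment m n k' l' q) ∨
    connectedComponentIn E (torusPoint m n (k + s) (l + (1 - s))) =
      antiparallelLine m n k' l' := by
  have hmem : torusPoint m n (k + s) (l + (1 - s)) ∈ E :=
    (hE.mem_iff k l hs ⟨by linarith [hs.2], by linarith [hs.1]⟩).2
      (Or.inr (Or.inr ⟨h, by ring⟩))
  have h' : U (k + 1) = reverseWord V (-l - 1 + 1) := by
    rw [h, reverseWord]; congr 2; ring
  have e : torusFlip (torusPoint m n (k + s) (l + (1 - s))) =
      torusPoint m n (k + s) (((-l - 1 : ℤ) : ℝ) + s) := by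
    rw [torusFlip_torusPoint]; push_cast; congr 1; ring
  obtain ⟨k', l', hc⟩ := hE.flip.parallel_component h' hs
  rw [← e, connectedComponentIn_torusFlip hmem] at hc
  rcases hc with ⟨q, hq, hc⟩ | hc
  · refine ⟨k', -l' - q, Or.inl ⟨q, hq, ?_⟩⟩
    rw [image_torusFlip_eq_iff.1 hc, image_torusFlip_parallelSegment]
  · refine ⟨k', -l', Or.inr ?_⟩
    rw [image_torusFlip_eq_iff.1 hc, image_torusFlip_parallelLine]

/-- Every component of a coincidence set has one of the five forms. -/
theorem IsCoincidenceSet.component_cases (hE : IsCoincidenceSet m n U V E) {x : Circle × Circle}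
    (hx : x ∈ E) : ∃ k l : ℤ,
      connectedComponentIn E x = {torusPoint m n k l} ∨
      (∃ q : ℕ, 0 < q ∧ connectedComponentIn E x = parallelSegment m n k l q) ∨
      (∃ q : ℕ, 0 < q ∧ connectedComponentIn E x = antiparallelSegment m n k l q) ∨
      connectedComponentIn E x = parallelLine m n k l ∨
      connectedComponentIn E x = antiparallelLine m n k l := by
  have hpar : ∀ {k l : ℤ} {s : ℝ}, U (k + 1) = V (l + 1) → s ∈ Icc (0 : ℝ) 1 →
      x = torusPoint m n (k + s) (l + s) → ∃ k' l' : ℤ,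
        (∃ q : ℕ, 0 < q ∧ connectedComponentIn E x = parallelSegment m n k' l' q) ∨
        connectedComponentIn E x = parallelLine m n k' l' := fun h hs hxs => by
    rw [hxs]; exact hE.parallel_component h hs
  have hanti : ∀ {k l : ℤ} {s : ℝ}, U (k + 1) = (V (l + 1)).inverse → s ∈ Icc (0 : ℝ) 1 →
      x = torusPoint m n (k + s) (l + (1 - s)) → ∃ k' l' : ℤ,
        (∃ q : ℕ, 0 < q ∧ connectedComponentIn E x = antiparallelSegment m n k' l' q) ∨
        connectedComponentIn E x = antiparallelLine m n k' l' := fun h hs hxs => by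
    rw [hxs]; exact hE.antiparallel_component h hs
  suffices (∃ k l : ℤ, connectedComponentIn E x = {torusPoint m n k l}) ∨
      (∃ k l : ℤ, (∃ q : ℕ, 0 < q ∧ connectedComponentIn E x = parallelSegment m n k l q) ∨
        connectedComponentIn E x = parallelLine m n k l) ∨
      ∃ k l : ℤ, (∃ q : ℕ, 0 < q ∧ connectedComponentIn E x = antiparallelSegment m n k l q) ∨
        connectedComponentIn E x = antiparallelLine m n k l by
    rcases this with ⟨k, l, h⟩ | ⟨k, l, h | h⟩ | ⟨k, l, h | h⟩
    · exact ⟨k, l, Or.inl h⟩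
    · exact ⟨k, l, Or.inr (Or.inl h)⟩
    · exact ⟨k, l, Or.inr (Or.inr (Or.inr (Or.inl h)))⟩
    · exact ⟨k, l, Or.inr (Or.inr (Or.inl h))⟩
    · exact ⟨k, l, Or.inr (Or.inr (Or.inr (Or.inr h)))⟩
  obtain ⟨s, t, hst⟩ := exists_torusPoint (m := m) (n := n) x
  have hs : Int.fract s ∈ Icc (0 : ℝ) 1 := ⟨Int.fract_nonneg s, (Int.fract_lt_one s).le⟩
  have ht : Int.fract t ∈ Icc (0 : ℝ) 1 := ⟨Int.fract_nonneg t, (Int.fract_lt_one t).le⟩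
  rw [← Int.floor_add_fract s, ← Int.floor_add_fract t] at hst
  set k := ⌊s⌋
  set l := ⌊t⌋
  rcases (hE.mem_iff k l hs ht).1 (hst ▸ hx) with ⟨h1, h2⟩ | ⟨h1, h2⟩ | ⟨h1, h2⟩
  · have h1' : Int.fract s = 0 := h1.resolve_right (Int.fract_lt_one s).ne
    have h2' : Int.fract t = 0 := h2.resolve_right (Int.fract_lt_one t).ne
    rw [h1', h2', add_zero, add_zero] at hst
    -- At a lattice point each of the four adjacent squares may supply a branch. The point is the
    -- start (s = 0) or the end (s = 1) of that branch; without any branch it is isolated.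
    by_cases c1 : U (k + 1) = V (l + 1)
    · exact Or.inr (Or.inl (hpar c1 (s := 0) (by simp) (by rw [hst]; congr 1 <;> ring)))
    by_cases c2 : U k = V l
    · exact Or.inr (Or.inl (hpar (k := k - 1) (l := l - 1) (s := 1)
        (by rwa [sub_add_cancel, sub_add_cancel]) (by simp)
        (by rw [hst]; push_cast; congr 1 <;> ring)))
    by_cases c3 : U (k + 1) = (V l).inverse
    · exact Or.inr (Or.inr (hanti (k := k) (l := l - 1) (s := 0) (by rwa [sub_add_cancel]) (by simp)
        (by rw [hst]; push_cast; congr 1 <;> ring)))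
    by_cases c4 : U k = (V (l + 1)).inverse
    · exact Or.inr (Or.inr (hanti (k := k - 1) (l := l) (s := 1) (by rwa [sub_add_cancel]) (by simp)
        (by rw [hst]; push_cast; congr 1 <;> ring)))
    exact Or.inl ⟨k, l, by rw [hst]; exact hE.isolated_component c1 c2 c3 c4⟩
  · exact Or.inr (Or.inl (hpar h1 hs (by rw [hst, h2])))
  · exact Or.inr (Or.inr (hanti h1 hs (by rw [hst, h2]; congr 1; ring)))

end Flip

/-- The geometry enters (A) and (C) only through this statement; the rest is combinatorics of the
two words. -/
theorem isCoincidenceSet_cvp {g m n : ℕ} [Nat.AtLeastTwo g] [NeZero m] [NeZero n]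
    {u : Fin m → Letter g} {v : Fin n → Letter g} (hu : CyclicallyReduced u)
    (hv : CyclicallyReduced v) {φ ψ : C(Circle, Surface g)} (hφ : IsPiecewiseGeodesicLoop u φ)
    (hψ : IsPiecewiseGeodesicLoop v ψ) :
    IsCoincidenceSet m n (letterAt u) (letterAt v) (cvp φ ψ) where
  periodic_left := letterAt_add_mul u
  periodic_right := letterAt_add_mul v
  reduced_left := hu
  reduced_right := hv
  mem_iff k l _ _ hs ht := loop_eq_loop_iff hφ hψ k l hs ht

end CommonValue

end

theorem mainTheorem6 {g m n : ℕ} [Nat.AtLeastTwo g] [NeZero m] [NeZero n]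
    (u : Fin m → CommonValue.Letter g) (v : Fin n → CommonValue.Letter g)
    (hu : CommonValue.CyclicallyReduced u) (hv : CommonValue.CyclicallyReduced v)
    (φ ψ : C(Circle, CommonValue.Surface g))
    (hφ : CommonValue.IsPiecewiseGeodesicLoop u φ)
    (hψ : CommonValue.IsPiecewiseGeodesicLoop v ψ) :
    -- every component has one of the five forms
    (∀ x ∈ CommonValue.cvp φ ψ, ∃ k l : ℤ,
      connectedComponentIn (CommonValue.cvp φ ψ) x = {CommonValue.torusPoint m n k l} ∨
      (∃ q : ℕ, 0 < q ∧ connectedComponentIn (CommonValue.cvp φ ψ) x =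
        CommonValue.parallelSegment m n k l q) ∨
      (∃ q : ℕ, 0 < q ∧ connectedComponentIn (CommonValue.cvp φ ψ) x =
        CommonValue.antiparallelSegment m n k l q) ∨
      connectedComponentIn (CommonValue.cvp φ ψ) x = CommonValue.parallelLine m n k l ∨
      connectedComponentIn (CommonValue.cvp φ ψ) x = CommonValue.antiparallelLine m n k l) ∧
    -- the common value class that contains a lattice pair
    (∀ f h : ℝ → UpperHalfPlane,
      CommonValue.IsStandardLifting φ f → CommonValue.IsStandardLifting ψ h → ∀ k l : ℤ,
      CommonValue.torusPoint m n k l ∈ CommonValue.classOf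
        (fun t => (CommonValue.prefixDeck u k)⁻¹ • f t)
        (fun t => (CommonValue.prefixDeck v l)⁻¹ • h t) ∧
      ∀ C : Set (Circle × Circle), (CommonValue.IsCommonValueClass φ ψ C ∧
          CommonValue.torusPoint m n k l ∈ C) ↔
        C = CommonValue.classOf
          (fun t => (CommonValue.prefixDeck u k)⁻¹ • f t)
          (fun t => (CommonValue.prefixDeck v l)⁻¹ • h t)) ∧
    -- the letters of the words for each of the five forms
    (∀ x ∈ CommonValue.cvp φ ψ, ∀ k l : ℤ,
      (connectedComponentIn (CommonValue.cvp φ ψ) x = {CommonValue.torusPoint m n k l} →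
        CommonValue.letterAt u k ≠ CommonValue.letterAt v l ∧
        CommonValue.letterAt u (k + 1) ≠ CommonValue.letterAt v (l + 1) ∧
        (CommonValue.letterAt v l).inverse ≠ CommonValue.letterAt u (k + 1) ∧
        CommonValue.letterAt u k ≠ (CommonValue.letterAt v (l + 1)).inverse) ∧
      (∀ q : ℕ, 0 < q → connectedComponentIn (CommonValue.cvp φ ψ) x =
          CommonValue.parallelSegment m n k l q →
        connectedComponentIn (CommonValue.cvp φ ψ) x ≠ CommonValue.parallelLine m n k l →
        (∀ r : ℤ, 1 ≤ r → r ≤ q →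
          CommonValue.letterAt u (k + r) = CommonValue.letterAt v (l + r)) ∧
        CommonValue.letterAt u k ≠ CommonValue.letterAt v l ∧
        CommonValue.letterAt u (k + q + 1) ≠ CommonValue.letterAt v (l + q + 1)) ∧
      (∀ q : ℕ, 0 < q → connectedComponentIn (CommonValue.cvp φ ψ) x =
          CommonValue.antiparallelSegment m n k l q →
        connectedComponentIn (CommonValue.cvp φ ψ) x ≠
          CommonValue.antiparallelLine m n k (l + q) →
        (∀ r : ℤ, 1 ≤ r → r ≤ q → CommonValue.letterAt u (k + r) =
          (CommonValue.letterAt v (l + q - r + 1)).inverse) ∧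
        CommonValue.letterAt u k ≠ (CommonValue.letterAt v (l + q + 1)).inverse ∧
        CommonValue.letterAt u (k + q + 1) ≠ (CommonValue.letterAt v l).inverse) ∧
      (connectedComponentIn (CommonValue.cvp φ ψ) x = CommonValue.parallelLine m n k l →
        ∀ r : ℤ, CommonValue.letterAt u (k + r) = CommonValue.letterAt v (l + r)) ∧
      (connectedComponentIn (CommonValue.cvp φ ψ) x = CommonValue.antiparallelLine m n k l →
        ∀ r : ℤ, CommonValue.letterAt u (k + r) =
          (CommonValue.letterAt v (l - r + 1)).inverse)) := by
  have hE := CommonValue.isCoincidenceSet_cvp hu hv hφ hψ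
  refine ⟨fun x hx => hE.component_cases hx, fun f h hf hh k l =>
    ⟨CommonValue.torusPoint_mem_classOf hφ hψ hf hh k l, fun C =>
      CommonValue.isCommonValueClass_and_mem_iff hφ hψ hf hh k l C⟩, fun x hx k l => ?_⟩
  -- The antiparallel assertions, and the two conditions with inverse letters at an isolated point,
  -- are the parallel ones for the flipped set.
  have hflip := CommonValue.connectedComponentIn_torusFlip hx
  refine ⟨fun h => ?_, fun q _ h hne => hE.letters_of_parallelSegment h hne,
    fun q _ h hne => ?_, fun h => hE.letters_of_parallelLine h, fun h r => ?_⟩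
  · obtain ⟨h1, h2⟩ := hE.letters_of_singleton h
    rw [h, Set.image_singleton, CommonValue.torusFlip_torusPoint, ← Int.cast_neg] at hflip
    obtain ⟨h3, h4⟩ := hE.flip.letters_of_singleton hflip
    refine ⟨h1, h2, fun h5 => h4 ?_, fun h5 => h3 ?_⟩
    · rw [← h5, CommonValue.reverseWord]; congr 2; ring
    · rw [h5, CommonValue.reverseWord]; congr 2; ring
  · rw [h, CommonValue.image_torusFlip_antiparallelSegment] at hflip
    -- An antiparallel segment starts at (k, l+q), so the closed curve containing it has data k and
    -- l+q, and its flip has data k and -(l+q).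
    have hne' : connectedComponentIn (CommonValue.torusFlip '' CommonValue.cvp φ ψ)
        (CommonValue.torusFlip x) ≠ CommonValue.parallelLine m n k (-(l + q)) := by
      rw [CommonValue.connectedComponentIn_torusFlip hx, Ne, CommonValue.image_torusFlip_eq_iff,
        CommonValue.image_torusFlip_parallelLine, neg_neg]
      exact hne
    obtain ⟨h1, h2, h3⟩ := hE.flip.letters_of_parallelSegment hflip hne'
    refine ⟨fun r hr hr' => ?_, fun h4 => h2 ?_, fun h4 => h3 ?_⟩
    · rw [h1 r hr hr', CommonValue.reverseWord]; congr 2; ring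
    · rw [h4, CommonValue.reverseWord]; congr 2; ring
    · rw [h4, CommonValue.reverseWord]; congr 2; ring
  · rw [h, CommonValue.image_torusFlip_antiparallelLine] at hflip
    rw [hE.flip.letters_of_parallelLine hflip r, CommonValue.reverseWord]; congr 2; ring
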